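/- Let $G$ be a (discrete) group. For $k\in\mathbb N$ let $C_k(G;\mathbb R)=\bigoplus_{g\in G^k}\mathbb R\cdot g$, with the $\ell^1$-norm $\|\cdot\|_1$ with respect to the basis $G^k$ and the boundary operator $\partial_k\colon C_k(G;\mathbb R)\to C_{k-1}(G;\mathbb R)$ ($k\geq 1$), $$\partial_k(g_1,\dots,g_k)=(g_2,\dots,g_k)+\sum_{j=1}^{k-1}(-1)^j(g_1,\dots,g_j g_{j+1},\dots,g_k)+(-1)^k(g_1,\dots,g_{k-1}).$$ Let $C_b^k(G;\mathbb R)$ be the space of all linear functionals on $C_k(G;\mathbb R)$ that are bounded with respect to $\|\cdot\|_1$; with the coboundary operators $f\mapsto f\circ\partial_{k+1}$ these form a cochain complex, whose cohomology $H_b^*(G;\mathbb R)$ is the bounded cohomology of $G$. The bounded-cohomological dimension of $G$ is $$\operatorname{bcd}(G)=\sup\{n\in\mathbb N\mid H_b^n(G;\mathbb R)\not\cong 0\}\in\mathbb N\cup\{\infty\}.$$ If $H$ is a subgroup of a group $M$, then $M$ is called a mitosis of $H$ if there exist $s,d\in M$ such that 1. $M$ is generated by $H\cup\{s,d\}$;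 2. $d h d^{-1}=h\cdot s h s^{-1}$ for all $h\in H$; 3. $[h', s h s^{-1}]=1$ for all $h,h'\in H$. A group $G$ is called mitotic if for every finitely generated subgroup $H\subset G$ there is a subgroup $M\subset G$ with $H\subset M$ that is a mitosis of $H$. **Theorem.** If $G$ is a mitotic group, then $\operatorname{bcd}(G)=0$, i.e. $H_b^n(G;\mathbb R)\cong 0$ for all $n>0$. -/

import Mathlib

/-!
Bounded cohomology of discrete groups with trivial real coefficients, bounded-cohomological
dimension, and mitotic groups.
-/

namespace BoundedCohomology

/-! ### The bar complex -/

/-- The `j`-th face (`0 ≤ j ≤ k + 1`) of a tuple `(g₁, …, g_{k+1})`: for `j = 0` the first entry is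
dropped, for `j = k + 1` the last entry is dropped, and for `1 ≤ j ≤ k` the neighbouring entries
`g_j`, `g_{j+1}` are replaced by their product `g_j * g_{j+1}`. (Entries of a tuple
`Fin (k + 1) → G` are numbered from `0` in the code.) -/
def barFace {G : Type*} [Group G] {k : ℕ} (j : Fin (k + 2)) (g : Fin (k + 1) → G) : Fin k → G :=
  fun i =>
    if (i : ℕ) + 1 < (j : ℕ) then g i.castSucc
    else if (i : ℕ) + 1 = (j : ℕ) then g i.castSucc * g i.succ
    else g i.succ

/-- The chain module `C_k(G; ℝ)`: the real vector space with basis `G ^ k`. -/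
abbrev BarChain (G : Type*) (k : ℕ) : Type _ := (Fin k → G) →₀ ℝ

/-- The boundary operator `∂_{k+1} : C_{k+1}(G; ℝ) → C_k(G; ℝ)`, the linear map which sends a basis
element `g` to the alternating sum of its faces; see `barBoundary_single` for the expanded form. -/
noncomputable def barBoundary (G : Type*) [Group G] (k : ℕ) :
    BarChain G (k + 1) →ₗ[ℝ] BarChain G k :=
  Finsupp.linearCombination ℝ fun g : Fin (k + 1) → G =>
    ∑ j : Fin (k + 2), (-1 : ℝ) ^ (j : ℕ) • Finsupp.single (barFace j g) (1 : ℝ)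

theorem barFace_zero {G : Type*} [Group G] {k : ℕ} (g : Fin (k + 1) → G) :
    barFace 0 g = Fin.tail g := by
  funext i
  simp [barFace, Fin.tail]

theorem barFace_last {G : Type*} [Group G] {k : ℕ} (g : Fin (k + 1) → G) :
    barFace (Fin.last (k + 1)) g = Fin.init g := by
  funext i
  have := i.isLt
  simp [barFace, Fin.init]

/-- The middle faces are Mathlib's `Fin.contractNth`, which multiplies two neighbouring entries. -/
theorem barFace_succ {G : Type*} [Group G] {k : ℕ} (j : Fin (k + 1)) (g : Fin (k + 1) → G) :
    barFace j.succ g = Fin.contractNth j (· * ·) g := by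
  funext i
  simp [barFace, Fin.contractNth]

/-- `∂ (g₁, …, g_{k+1}) = (g₂, …, g_{k+1}) + ∑_{j=1}^{k} (-1)^j (g₁, …, g_j g_{j+1}, …, g_{k+1})
+ (-1)^{k+1} (g₁, …, g_k)`. -/
theorem barBoundary_single {G : Type*} [Group G] {k : ℕ} (g : Fin (k + 1) → G) :
    barBoundary G k (Finsupp.single g 1) =
      Finsupp.single (Fin.tail g) 1
      + ∑ j : Fin k, (-1 : ℝ) ^ ((j : ℕ) + 1) •
          Finsupp.single (Fin.contractNth j.castSucc (· * ·) g) (1 : ℝ)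
      + (-1 : ℝ) ^ (k + 1) • Finsupp.single (Fin.init g) (1 : ℝ) := by
  rw [barBoundary, Finsupp.linearCombination_single, one_smul, Fin.sum_univ_succ,
    Fin.sum_univ_castSucc, barFace_zero, Fin.succ_last, barFace_last, ← add_assoc]
  simp [barFace_succ]

theorem barFace_barFace {G : Type*} [Group G] {k : ℕ} (i j : Fin (k + 2)) (h : i ≤ j)
    (g : Fin (k + 2) → G) :
    barFace i (barFace j.succ g) = barFace j (barFace i.castSucc g) := by
  funext l
  have h' : (i : ℕ) ≤ j := h
  simp only [barFace, Fin.val_castSucc, Fin.val_succ]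
  have e : l.castSucc.succ = l.succ.castSucc := rfl
  rw [e]
  split_ifs <;> first | rfl | omega | (simp only [mul_assoc])

theorem barBoundary_comp (G : Type*) [Group G] (k : ℕ) :
    barBoundary G k ∘ₗ barBoundary G (k + 1) = 0 := by
  ext g : 2
  simp only [LinearMap.comp_apply, Finsupp.lsingle_apply, LinearMap.zero_apply, barBoundary,
    Finsupp.linearCombination_single, map_sum, map_smul, Finset.smul_sum, smul_smul]
  rw [Finset.sum_comm, ← Finset.sum_product', Finset.univ_product_univ]
  let S : Finset (Fin (k + 2) × Fin (k + 3)) := {ij | (ij.2 : ℕ) ≤ (ij.1 : ℕ)}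
  rw [← Finset.sum_add_sum_compl S, ← eq_neg_iff_add_eq_zero, ← Finset.sum_neg_distrib]
  let φ : ∀ ij : Fin (k + 2) × Fin (k + 3), ij ∈ S → Fin (k + 2) × Fin (k + 3) := fun ij hij =>
    (Fin.castLT ij.2 (lt_of_le_of_lt (Finset.mem_filter.mp hij).right (Fin.is_lt ij.1)),
      ij.1.succ)
  apply Finset.sum_bij φ
  · intro ij hij
    simp_rw [S, φ, Finset.compl_filter, Finset.mem_filter_univ, Fin.val_succ,
      Fin.val_castLT] at hij ⊢
    omega
  · rintro ⟨i, j⟩ hij ⟨i', j'⟩ hij' h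
    simp only [φ, Prod.mk.injEq, Fin.ext_iff, Fin.val_castLT, Fin.val_succ] at h ⊢
    omega
  · rintro ⟨i', j'⟩ hij'
    simp_rw [S, Finset.compl_filter, Finset.mem_filter_univ, not_le] at hij'
    refine ⟨(⟨(j' : ℕ) - 1, by omega⟩, Fin.castSucc i'), ?_, ?_⟩
    · simp only [S, Finset.mem_filter_univ, Fin.val_castSucc]
      omega
    · simp only [φ, Prod.mk.injEq, Fin.ext_iff, Fin.val_castLT, Fin.val_succ, Fin.val_castSucc,
        true_and]
      omega
  · rintro ⟨i, j⟩ hij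
    have hij' : (j : ℕ) ≤ (i : ℕ) := (Finset.mem_filter.mp hij).right
    have hj : (j : ℕ) < k + 2 := lt_of_le_of_lt hij' i.isLt
    have key := barFace_barFace (j.castLT hj) i hij' g
    rw [Fin.castSucc_castLT] at key
    simp only [φ, Fin.val_succ, Fin.val_castLT, key, ← neg_smul]
    congr 1
    ring

/-- The cochain module `C^k(G; ℝ) = Hom(C_k(G; ℝ), ℝ)` of all linear functionals on chains. -/
abbrev Cochain (G : Type*) (k : ℕ) : Type _ := BarChain G k →ₗ[ℝ] ℝ

/-! ### The ℓ¹-norm and bounded cochains -/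

/-- The `ℓ¹`-norm on `C_k(G; ℝ)` with respect to the basis `G ^ k`. -/
noncomputable def l1Norm {G : Type*} {k : ℕ} (c : BarChain G k) : ℝ :=
  c.sum fun _ a => |a|

/-- The module `C_b^k(G; ℝ)` of bounded cochains: the topological dual of `C_k(G; ℝ)` with respect
to the `ℓ¹`-norm, that is, the space of all linear functionals on `C_k(G; ℝ)` which are bounded
with respect to the `ℓ¹`-norm. -/
def BddCochain (G : Type*) (k : ℕ) : Submodule ℝ (Cochain G k) where
  carrier := {f | ∃ C : ℝ, ∀ c : BarChain G k, |f c| ≤ C * l1Norm c}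
  zero_mem' := ⟨0, fun c => by simp⟩
  add_mem' := by
    rintro f f' ⟨C, hC⟩ ⟨C', hC'⟩
    refine ⟨C + C', fun c => ?_⟩
    rw [LinearMap.add_apply, add_mul]
    exact (abs_add_le _ _).trans (add_le_add (hC c) (hC' c))
  smul_mem' := by
    rintro a f ⟨C, hC⟩
    refine ⟨|a| * C, fun c => ?_⟩
    rw [LinearMap.smul_apply, smul_eq_mul, abs_mul, mul_assoc]
    exact mul_le_mul_of_nonneg_left (hC c) (abs_nonneg a)

theorem l1Norm_single {G : Type*} {k : ℕ} (g : Fin k → G) (a : ℝ) :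
    l1Norm (Finsupp.single g a) = |a| := by
  simp [l1Norm]

/-- A linear functional is bounded for the `ℓ¹`-norm iff it is bounded on the basis. -/
theorem mem_bddCochain_iff {G : Type*} {k : ℕ} (f : Cochain G k) :
    f ∈ BddCochain G k ↔ ∃ C : ℝ, ∀ g : Fin k → G, |f (Finsupp.single g 1)| ≤ C := by
  constructor
  · rintro ⟨C, hC⟩
    refine ⟨C, fun g => ?_⟩
    simpa [l1Norm_single] using hC (Finsupp.single g 1)
  · rintro ⟨C, hC⟩
    refine ⟨C, fun c => ?_⟩
    have hc : f c = ∑ g ∈ c.support, c g * f (Finsupp.single g 1) := by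
      conv_lhs => rw [← Finsupp.sum_single c, Finsupp.sum, map_sum]
      refine Finset.sum_congr rfl fun g _ => ?_
      rw [← smul_eq_mul, ← map_smul, Finsupp.smul_single, smul_eq_mul, mul_one]
    rw [hc, l1Norm, Finsupp.sum, Finset.mul_sum]
    refine (Finset.abs_sum_le_sum_abs _ _).trans (Finset.sum_le_sum fun g _ => ?_)
    rw [abs_mul, mul_comm]
    exact mul_le_mul_of_nonneg_right (hC g) (abs_nonneg _)

/-- The coboundary operator `δ^k : C^k(G; ℝ) → C^{k+1}(G; ℝ)`, `f ↦ f ∘ ∂_{k+1}`; by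
`coboundary_mem` it restricts to `C_b^k(G; ℝ) → C_b^{k+1}(G; ℝ)`. -/
noncomputable def coboundary (G : Type*) [Group G] (k : ℕ) :
    Cochain G k →ₗ[ℝ] Cochain G (k + 1) :=
  (barBoundary G k).dualMap

theorem coboundary_mem {G : Type*} [Group G] {k : ℕ} {f : Cochain G k}
    (hf : f ∈ BddCochain G k) : coboundary G k f ∈ BddCochain G (k + 1) := by
  obtain ⟨C, hC⟩ := (mem_bddCochain_iff f).1 hf
  refine (mem_bddCochain_iff _).2 ⟨∑ _j : Fin (k + 2), C, fun g => ?_⟩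
  rw [coboundary, LinearMap.dualMap_apply, barBoundary, Finsupp.linearCombination_single, one_smul,
    map_sum]
  refine (Finset.abs_sum_le_sum_abs _ _).trans (Finset.sum_le_sum fun j _ => ?_)
  rw [map_smul, smul_eq_mul, abs_mul, abs_pow, abs_neg, abs_one, one_pow, one_mul]
  exact hC _

theorem coboundary_coboundary {G : Type*} [Group G] {k : ℕ} (f : Cochain G k) :
    coboundary G (k + 1) (coboundary G k f) = 0 := by
  change f ∘ₗ (barBoundary G k ∘ₗ barBoundary G (k + 1)) = 0
  rw [barBoundary_comp, LinearMap.comp_zero]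

/-! ### Bounded cohomology -/

/-- Bounded `k`-cocycles: the kernel of `δ^k` on `C_b^k(G; ℝ)`. -/
noncomputable def bddCocycles (G : Type*) [Group G] (k : ℕ) :
    Submodule ℝ (Cochain G k) :=
  BddCochain G k ⊓ LinearMap.ker (coboundary G k)

/-- The image of `δ^{k-1} : C_b^{k-1}(G; ℝ) → C_b^k(G; ℝ)`, that is, the coboundaries of bounded
`(k-1)`-cochains; this is `0` for `k = 0`. -/
noncomputable def bddCoboundaries (G : Type*) [Group G] :
    (k : ℕ) → Submodule ℝ (Cochain G k)
  | 0 => ⊥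
  | k + 1 => (BddCochain G k).map (coboundary G k)

theorem bddCoboundaries_le_bddCocycles (G : Type*) [Group G] (k : ℕ) :
    bddCoboundaries G k ≤ bddCocycles G k := by
  cases k with
  | zero => exact bot_le
  | succ k =>
    rintro _ ⟨f, hf, rfl⟩
    exact ⟨coboundary_mem hf, coboundary_coboundary f⟩

/-- The quotient `Z / (B ∩ Z)` of a subspace `Z` of a real vector space by another subspace `B`. It is
only used for `B ≤ Z`, where it is `Z / B`. -/
def Subquotient {V : Type*} [AddCommGroup V] [Module ℝ V] (Z B : Submodule ℝ V) : Type _ :=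
  Z ⧸ B.submoduleOf Z

instance {V : Type*} [AddCommGroup V] [Module ℝ V] (Z B : Submodule ℝ V) :
    AddCommGroup (Subquotient Z B) :=
  inferInstanceAs (AddCommGroup (Z ⧸ B.submoduleOf Z))

instance {V : Type*} [AddCommGroup V] [Module ℝ V] (Z B : Submodule ℝ V) :
    Module ℝ (Subquotient Z B) :=
  inferInstanceAs (Module ℝ (Z ⧸ B.submoduleOf Z))

theorem subsingleton_subquotient_iff {V : Type*} [AddCommGroup V] [Module ℝ V]
    (Z B : Submodule ℝ V) : Subsingleton (Subquotient Z B) ↔ Z ≤ B := by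
  rw [Subquotient, Submodule.Quotient.subsingleton_iff, Submodule.submoduleOf_eq_top]

/-- The bounded cohomology `H_b^k(G; ℝ)`, a real vector space: bounded cocycles modulo coboundaries
of bounded cochains. -/
abbrev BddCohomology (G : Type*) [Group G] (k : ℕ) : Type _ :=
  Subquotient (bddCocycles G k) (bddCoboundaries G k)

theorem subsingleton_bddCohomology_iff (G : Type*) [Group G] (k : ℕ) :
    Subsingleton (BddCohomology G k) ↔ bddCocycles G k ≤ bddCoboundaries G k :=
  subsingleton_subquotient_iff _ _

/-- The bounded-cohomological dimension
`bcd G = sup {n ∈ ℕ | H_b^n(G; ℝ) ≇ 0} ∈ ℕ ∪ {∞}`. -/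
noncomputable def bcd (G : Type*) [Group G] : ℕ∞ :=
  sSup ((fun n : ℕ => (n : ℕ∞)) '' {n : ℕ | ¬ Subsingleton (BddCohomology G n)})

/-! ### Mitotic groups -/

/-- For a subgroup `G` of a group `M`: the group `M` is a mitosis of `G`. Here the conjugate `g ^ h`
stands for `h * g * h⁻¹`, and `[g', g ^ s] = 1` is written out. -/
def IsMitosis {M : Type*} [Group M] (G : Subgroup M) : Prop :=
  ∃ s d : M,
    Subgroup.closure ((G : Set M) ∪ {s, d}) = ⊤ ∧
    (∀ g ∈ G, d * g * d⁻¹ = g * (s * g * s⁻¹)) ∧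
    (∀ g ∈ G, ∀ g' ∈ G, g' * (s * g * s⁻¹) * g'⁻¹ * (s * g * s⁻¹)⁻¹ = 1)

/-- A group `M` is mitotic if every finitely generated subgroup `G` of `M` is contained in a
subgroup `M'` of `M` which is a mitosis of `G`. -/
def IsMitotic (M : Type*) [Group M] : Prop :=
  ∀ G : Subgroup M, G.FG → ∃ M' : Subgroup M, G ≤ M' ∧ IsMitosis (G.subgroupOf M')

end BoundedCohomology

/-!
A bounded cocycle `f` of positive degree is the coboundary of a bounded cochain as soon as chains
satisfy a *uniform boundary condition* (`UniformBoundary`): every cycle `z` has a filling `b` with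
`‖b‖₁ ≤ K ‖z‖₁`, where `K` depends on the degree only. Indeed `f` then vanishes on cycles, so it
factors as `f = φ ∘ ∂` with `φ` defined and bounded on the boundaries, and the Hahn–Banach theorem
extends `φ` to a bounded functional (`exists_bddCochain_coboundary_eq`).

For a mitotic group the uniform boundary condition is proved by induction on the degree. In degrees
`1, …, n` it provides a bounded operator `h` with `∂ h + h ∂ = id` (`exists_isContraction`). Let `z`
be a cycle of degree `n + 1`. Let `H` be a finitely generated subgroup that contains the entries of
all chains involved, let `s, d` be elements that witness a mitosis of `H`, and let `μ : H × H → G`,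
`μ (a, b) = a * (s * b * s⁻¹)`, which is a homomorphism. Conjugation is homotopic to the identity by
a bounded homotopy, and conjugation by `d` is `μ` composed with the diagonal of `H`. By the theorems
of Alexander–Whitney and Eilenberg–Zilber, `z` is therefore homologous to
`z + s z s⁻¹ + μ (cross terms)`, hence to `2 z + μ (cross terms)`. The cross terms are products
`a × b` in which both factors have degree between `1` and `n`; together they form a cycle, which is
the boundary of its image under `(-1)^{deg a} a ⊗ h b`. So `z` is itself a boundary, and all
operators in the argument are bounded independently of `z`, `H`, `s` and `d`
(`IsContraction.uniformBoundary`).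

The Alexander–Whitney and Eilenberg–Zilber maps and the homotopies are constructed on the free
vector space on lists of vertices of a *set* `X`, naturally in `X`. There the empty list is a
simplex of degree `-1`, and prefixing a vertex is a contraction of the augmented complex. Naturality
makes the operators equivariant, so that they descend to the bar complex, the coinvariants of the
complex of simplices with vertices in the group; it also bounds their norm on a simplex with `k`
vertices by the norm on the universal simplex `0, 1, …, k - 1`.
-/

open Finsupp TensorProduct

-- Groups of linear maps into spaces of linear maps or tensor products need deeper instance search.
set_option maxSynthPendingDepth 3

namespace BoundedCohomology

/-! ### The `ℓ¹`-norm -/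

/-- The `ℓ¹`-norm of a finitely supported function, on an arbitrary basis; `l1Norm` is the special
case of tuples. -/
noncomputable def norm1 {α : Type*} (c : α →₀ ℝ) : ℝ := c.sum fun _ a => |a|

section Norm
variable {α β : Type*}

theorem norm1_eq_sum (c : α →₀ ℝ) : norm1 c = ∑ a ∈ c.support, |c a| := rfl

theorem norm1_eq_sum_of_subset {c : α →₀ ℝ} {s : Finset α} (h : c.support ⊆ s) :
    norm1 c = ∑ a ∈ s, |c a| :=
  Finsupp.sum_of_support_subset c h _ (by simp)

theorem norm1_nonneg (c : α →₀ ℝ) : 0 ≤ norm1 c :=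
  Finset.sum_nonneg fun _ _ => abs_nonneg _

@[simp] theorem norm1_zero : norm1 (0 : α →₀ ℝ) = 0 := by simp [norm1]

@[simp] theorem norm1_single (a : α) (r : ℝ) : norm1 (single a r) = |r| := by simp [norm1]

theorem norm1_add_le (c d : α →₀ ℝ) : norm1 (c + d) ≤ norm1 c + norm1 d := by
  classical
  rw [norm1_eq_sum_of_subset (c := c + d) Finsupp.support_add,
    norm1_eq_sum_of_subset (c := c) (s := c.support ∪ d.support) Finset.subset_union_left,
    norm1_eq_sum_of_subset (c := d) (s := c.support ∪ d.support) Finset.subset_union_right,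
    ← Finset.sum_add_distrib]
  exact Finset.sum_le_sum fun a _ => abs_add_le _ _

theorem norm1_smul (r : ℝ) (c : α →₀ ℝ) : norm1 (r • c) = |r| * norm1 c := by
  rw [norm1_eq_sum_of_subset (c := r • c) Finsupp.support_smul, norm1_eq_sum, Finset.mul_sum]
  simp [abs_mul]

@[simp] theorem norm1_neg (c : α →₀ ℝ) : norm1 (-c) = norm1 c := by
  rw [← neg_one_smul ℝ, norm1_smul]; simp

theorem norm1_sub_le (c d : α →₀ ℝ) : norm1 (c - d) ≤ norm1 c + norm1 d := by
  rw [sub_eq_add_neg, ← norm1_neg d]; exact norm1_add_le _ _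

theorem norm1_sum_le {ι : Type*} (s : Finset ι) (f : ι → α →₀ ℝ) :
    norm1 (∑ i ∈ s, f i) ≤ ∑ i ∈ s, norm1 (f i) :=
  Finset.le_sum_of_subadditive norm1 norm1_zero.le norm1_add_le s f

/-- A linear map that is bounded by `K` on the basis elements that occur in `c` is bounded by `K`
at `c`. -/
theorem norm1_map_le (L : (α →₀ ℝ) →ₗ[ℝ] (β →₀ ℝ)) (K : ℝ) (c : α →₀ ℝ)
    (h : ∀ a ∈ c.support, norm1 (L (single a 1)) ≤ K) : norm1 (L c) ≤ K * norm1 c := by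
  have hc : L c = ∑ a ∈ c.support, c a • L (single a 1) := by
    conv_lhs => rw [← Finsupp.sum_single c, Finsupp.sum, map_sum]
    refine Finset.sum_congr rfl fun a _ => ?_
    rw [← map_smul, Finsupp.smul_single, smul_eq_mul, mul_one]
  rw [hc, norm1_eq_sum c, Finset.mul_sum]
  refine (norm1_sum_le _ _).trans (Finset.sum_le_sum fun a ha => ?_)
  rw [norm1_smul, mul_comm]
  exact mul_le_mul_of_nonneg_right (h a ha) (abs_nonneg _)

theorem norm1_lmapDomain_le (f : α → β) (c : α →₀ ℝ) :
    norm1 (lmapDomain ℝ ℝ f c) ≤ norm1 c := by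
  simpa using norm1_map_le (lmapDomain ℝ ℝ f) 1 c (by simp)

end Norm

/-! ### Simplices as lists -/

/-- The real vector space with basis the lists in `X`. A list is used in two ways: as the simplex
with the given vertices (so a list of length `n + 1` has degree `n`, and the empty list has degree
`-1`), and, if `X` is a group, as a basis element of the bar complex (of degree `n` if the length
is `n`). -/
abbrev ListChain (X : Type*) : Type _ := List X →₀ ℝ

section Simplices
variable {X Y X' Y' : Type*}

/-- The cone with apex `x`: `x` is prefixed to every list. -/
noncomputable def cone (x : X) : ListChain X →ₗ[ℝ] ListChain X := lmapDomain ℝ ℝ (List.cons x)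

/-- The map of chains induced by a map of vertices, or of entries of bar chains. -/
noncomputable def mapChain (f : X → Y) : ListChain X →ₗ[ℝ] ListChain Y :=
  lmapDomain ℝ ℝ (List.map f)

/-- The boundary of the augmented complex of simplices: the alternating sum of the faces of a list.
The boundary of a vertex is the empty list. -/
noncomputable def bd : ListChain X →ₗ[ℝ] ListChain X :=
  linearCombination ℝ fun l : List X =>
    ∑ j ∈ Finset.range l.length, (-1 : ℝ) ^ j • single (l.eraseIdx j) (1 : ℝ)

/-- The sign `(-1) ^ l.length`. On simplices this is the negative of `(-1) ^ degree`, on bar chains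
it is `(-1) ^ degree`. -/
noncomputable def sgn : ListChain X →ₗ[ℝ] ListChain X :=
  linearCombination ℝ fun l : List X => (-1 : ℝ) ^ l.length • single l (1 : ℝ)

@[simp] theorem cone_single (x : X) (l : List X) (r : ℝ) :
    cone x (single l r) = single (x :: l) r := by simp [cone]

@[simp] theorem mapChain_single (f : X → Y) (l : List X) (r : ℝ) :
    mapChain f (single l r) = single (l.map f) r := by simp [mapChain]

theorem bd_single (l : List X) : bd (single l (1 : ℝ)) =
    ∑ j ∈ Finset.range l.length, (-1 : ℝ) ^ j • single (l.eraseIdx j) (1 : ℝ) := by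
  simp [bd]

theorem sgn_single (l : List X) : sgn (single l (1 : ℝ)) = (-1 : ℝ) ^ l.length • single l 1 := by
  simp [sgn]

@[simp] theorem bd_nil : bd (single ([] : List X) (1 : ℝ)) = 0 := by simp [bd_single]

/-- Two linear maps on chains agree if they agree on lists. -/
theorem chain_ext {V : Type*} [AddCommMonoid V] [Module ℝ V] {φ ψ : ListChain X →ₗ[ℝ] V}
    (h : ∀ l, φ (single l 1) = ψ (single l 1)) (c : ListChain X) : φ c = ψ c := by
  have : φ = ψ := Finsupp.lhom_ext' fun l => LinearMap.ext_ring (h l)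
  rw [this]

/-- Cones contract the augmented complex. -/
theorem bd_cone (x : X) (c : ListChain X) : bd (cone x c) = c - cone x (bd c) := by
  refine chain_ext (φ := bd ∘ₗ cone x) (ψ := LinearMap.id - cone x ∘ₗ bd) (fun l => ?_) c
  simp only [LinearMap.comp_apply, cone_single, bd_single, LinearMap.sub_apply, LinearMap.id_apply,
    List.length_cons, Finset.sum_range_succ', List.eraseIdx_cons_succ, map_sum, map_smul]
  simp [pow_succ, sub_eq_add_neg, add_comm]

theorem bd_bd (c : ListChain X) : bd (bd c) = 0 := by
  refine chain_ext (φ := bd ∘ₗ bd) (ψ := 0) (fun l => ?_) c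
  induction l with
  | nil => simp
  | cons x l ih =>
    have := bd_cone x (single l (1 : ℝ))
    rw [cone_single] at this
    simp only [LinearMap.comp_apply, LinearMap.zero_apply] at ih ⊢
    rw [this, map_sub, bd_cone, ih]
    simp

theorem bd_mapChain (f : X → Y) (c : ListChain X) : bd (mapChain f c) = mapChain f (bd c) := by
  refine chain_ext (φ := bd ∘ₗ mapChain f) (ψ := mapChain f ∘ₗ bd) (fun l => ?_) c
  simp [bd_single, List.eraseIdx_map]

theorem sgn_cone (x : X) (c : ListChain X) : sgn (cone x c) = -cone x (sgn c) := by
  refine chain_ext (φ := sgn ∘ₗ cone x) (ψ := -(cone x ∘ₗ sgn)) (fun l => ?_) c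
  simp [sgn_single, pow_succ]

theorem sgn_sgn (c : ListChain X) : sgn (sgn c) = c := by
  refine chain_ext (φ := sgn ∘ₗ sgn) (ψ := LinearMap.id) (fun l => ?_) c
  simp only [LinearMap.comp_apply, sgn_single, map_smul, LinearMap.id_apply]
  rw [smul_smul, ← mul_pow]
  simp

theorem sgn_bd (c : ListChain X) : sgn (bd c) = -bd (sgn c) := by
  refine chain_ext (φ := sgn ∘ₗ bd) (ψ := -(bd ∘ₗ sgn)) (fun l => ?_) c
  simp only [LinearMap.comp_apply, bd_single, LinearMap.neg_apply, sgn_single, map_smul, map_sum,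
    Finset.smul_sum, ← Finset.sum_neg_distrib]
  refine Finset.sum_congr rfl fun j hj => ?_
  have hj := Finset.mem_range.1 hj
  obtain ⟨n, hn⟩ : ∃ n, l.length = n + 1 := ⟨l.length - 1, by omega⟩
  rw [List.length_eraseIdx_of_lt hj, hn, smul_smul, smul_smul, ← neg_smul]
  congr 1
  simp [pow_succ, mul_comm]

theorem sgn_mapChain (f : X → Y) (c : ListChain X) : sgn (mapChain f c) = mapChain f (sgn c) := by
  refine chain_ext (φ := sgn ∘ₗ mapChain f) (ψ := mapChain f ∘ₗ sgn) (fun l => ?_) c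
  simp [sgn_single]

theorem mapChain_cone (f : X → Y) (x : X) (c : ListChain X) :
    mapChain f (cone x c) = cone (f x) (mapChain f c) := by
  refine chain_ext (φ := mapChain f ∘ₗ cone x) (ψ := cone (f x) ∘ₗ mapChain f) (fun l => ?_) c
  simp

theorem mapChain_mapChain {Z : Type*} (g : Y → Z) (f : X → Y) (c : ListChain X) :
    mapChain g (mapChain f c) = mapChain (g ∘ f) c := by
  refine chain_ext (φ := mapChain g ∘ₗ mapChain f) (ψ := mapChain (g ∘ f)) (fun l => ?_) c
  simp

theorem mapChain_id (c : ListChain X) : mapChain id c = c := by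
  refine chain_ext (φ := mapChain id) (ψ := LinearMap.id) (fun l => ?_) c
  simp

theorem norm1_mapChain_le (f : X → Y) (c : ListChain X) : norm1 (mapChain f c) ≤ norm1 c :=
  norm1_lmapDomain_le _ c

theorem norm1_cone_le (x : X) (c : ListChain X) : norm1 (cone x c) ≤ norm1 c :=
  norm1_lmapDomain_le _ c

/-- The coefficient of the empty list. -/
noncomputable def coeffNil : ListChain X →ₗ[ℝ] ℝ := Finsupp.lapply []

@[simp] theorem coeffNil_nil : coeffNil (single ([] : List X) (1 : ℝ)) = 1 := by simp [coeffNil]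

@[simp] theorem coeffNil_cons (x : X) (l : List X) : coeffNil (single (x :: l) (1 : ℝ)) = 0 := by
  simp [coeffNil]

@[simp] theorem coeffNil_cone (x : X) (c : ListChain X) : coeffNil (cone x c) = 0 :=
  chain_ext (φ := coeffNil ∘ₗ cone x) (ψ := 0) (by simp) c

@[simp] theorem coeffNil_sgn (c : ListChain X) : coeffNil (sgn c) = coeffNil c := by
  refine chain_ext (φ := coeffNil ∘ₗ sgn) (ψ := coeffNil) (fun l => ?_) c
  cases l <;> simp only [LinearMap.comp_apply, sgn_single, map_smul] <;> simp

@[simp] theorem coeffNil_mapChain (f : X → Y) (c : ListChain X) :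
    coeffNil (mapChain f c) = coeffNil c := by
  refine chain_ext (φ := coeffNil ∘ₗ mapChain f) (ψ := coeffNil) (fun l => ?_) c
  cases l <;> simp

/-! ### The cross product -/

/-- The Eilenberg–Zilber product of two simplices: the signed sum over all monotone lattice paths
from the first to the last pair of vertices. After the starting point `(x, y)` such a path advances
either in the first or in the second coordinate; the last summand is the path that ends at once.
Products with the empty simplex are `0`. -/
noncomputable def crossList : List X → List Y → ListChain (X × Y)
  | [], _ => 0
  | _ :: _, [] => 0
  | x :: l, y :: m =>
    cone (x, y) (crossList l (y :: m) + (-1 : ℝ) ^ l.length • crossList (x :: l) m +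
      single [] (coeffNil (single l 1) * coeffNil (single m 1)))
termination_by l m => l.length + m.length

/-- The bilinear extension of `crossList`. -/
noncomputable def cross : ListChain X →ₗ[ℝ] ListChain Y →ₗ[ℝ] ListChain (X × Y) :=
  linearCombination ℝ fun l : List X => linearCombination ℝ fun m : List Y => crossList l m

theorem cross_single (l : List X) (m : List Y) :
    cross (single l 1) (single m 1) = crossList l m := by
  simp [cross]

theorem chain_ext₂ {V : Type*} [AddCommMonoid V] [Module ℝ V]
    {φ ψ : ListChain X →ₗ[ℝ] ListChain Y →ₗ[ℝ] V}
    (h : ∀ l m, φ (single l 1) (single m 1) = ψ (single l 1) (single m 1))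
    (c : ListChain X) (d : ListChain Y) : φ c d = ψ c d := by
  rw [chain_ext (fun l => LinearMap.ext fun d => chain_ext (h l) d) c]

@[simp] theorem cross_nil_left (b : ListChain Y) : cross (single ([] : List X) 1) b = 0 :=
  chain_ext (ψ := 0) (fun m => by simp [cross_single, crossList]) b

@[simp] theorem cross_nil_right (a : ListChain X) : cross a (single ([] : List Y) 1) = 0 := by
  refine chain_ext (φ := cross.flip (single ([] : List Y) 1)) (ψ := 0) (fun l => ?_) a
  cases l <;> simp [cross_single, crossList]

theorem cross_cone (x : X) (y : Y) (a : ListChain X) (b : ListChain Y) :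
    cross (cone x a) (cone y b) = cone (x, y) (cross a (cone y b) + cross (cone x (sgn a)) b +
      (coeffNil a * coeffNil b) • single [] 1) := by
  refine chain_ext₂ (φ := cross.compl₁₂ (cone x) (cone y))
    (ψ := (cross.compl₁₂ LinearMap.id (cone y) + cross.compl₁₂ (cone x ∘ₗ sgn) LinearMap.id +
      ((LinearMap.mul ℝ ℝ).compl₁₂ coeffNil coeffNil).compr₂
        (LinearMap.toSpanSingleton ℝ _ (single [] 1))).compr₂ (cone (x, y))) (fun l m => ?_) a b
  simp only [LinearMap.compl₁₂_apply, LinearMap.compr₂_apply, LinearMap.add_apply,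
    LinearMap.comp_apply, LinearMap.id_apply, sgn_single, map_smul, LinearMap.smul_apply,
    cone_single, cross_single, LinearMap.mul_apply', LinearMap.toSpanSingleton_apply, crossList]
  simp

/-- The Leibniz rule for the product. The last term occurs only for a product of two vertices, as
the boundary of a vertex is the empty list while products with the empty list are `0`. -/
theorem bd_cross (a : ListChain X) (b : ListChain Y) :
    bd (cross a b) = cross (bd a) b - cross (sgn a) (bd b) +
      (coeffNil (bd a) * coeffNil (bd b)) • single [] 1 := by
  refine chain_ext₂ (φ := cross.compr₂ bd)
    (ψ := (cross (X := X) (Y := Y)).compl₁₂ bd LinearMap.id -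
      (cross (X := X) (Y := Y)).compl₁₂ sgn bd +
      ((LinearMap.mul ℝ ℝ).compl₁₂ (coeffNil ∘ₗ bd) (coeffNil ∘ₗ bd)).compr₂
        (LinearMap.toSpanSingleton ℝ _ (single [] (1 : ℝ)))) (fun l m => ?_) a b
  simp only [LinearMap.compr₂_apply, LinearMap.add_apply, LinearMap.sub_apply,
    LinearMap.compl₁₂_apply, LinearMap.id_apply, LinearMap.comp_apply, LinearMap.mul_apply',
    LinearMap.toSpanSingleton_apply]
  induction l generalizing m with
  | nil => simp [sgn_single]
  | cons x l ihl =>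
    induction m with
    | nil => simp
    | cons y m ihm =>
      have ih₁ := ihl (y :: m)
      -- the inductive hypothesis at `(x :: l, m)`, multiplied by the sign of `l`
      have ih₂ : bd (cross (cone x (sgn (single l 1))) (single m 1)) =
          cross (bd (cone x (sgn (single l 1)))) (single m 1) -
          cross (sgn (cone x (sgn (single l 1)))) (bd (single m 1)) +
          (coeffNil (bd (cone x (sgn (single l 1)))) * coeffNil (bd (single m 1))) •
            single [] 1 := by
        rw [sgn_single]
        simp only [map_smul, cone_single, LinearMap.smul_apply, ihm, smul_add, smul_sub, smul_smul,
          smul_eq_mul, mul_assoc]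
      rw [← cone_single, ← cone_single] at *
      set a := single l (1 : ℝ)
      set b := single m (1 : ℝ)
      simp only [cross_cone, bd_cone, map_add, map_sub, map_smul, map_neg, ih₁, ih₂, sgn_cone,
        LinearMap.sub_apply, LinearMap.neg_apply, coeffNil_cone, coeffNil_sgn,
        sgn_sgn, sgn_bd, bd_nil, map_zero, sub_zero]
      simp only [cone_single]
      module

theorem mapChain_cross (f : X → X') (g : Y → Y') (a : ListChain X) (b : ListChain Y) :
    mapChain (Prod.map f g) (cross a b) = cross (mapChain f a) (mapChain g b) := by
  refine chain_ext₂ (φ := cross.compr₂ (mapChain (Prod.map f g)))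
    (ψ := cross.compl₁₂ (mapChain f) (mapChain g)) (fun l m => ?_) a b
  simp only [LinearMap.compr₂_apply, LinearMap.compl₁₂_apply]
  induction l generalizing m with
  | nil => simp
  | cons x l ihl =>
    induction m with
    | nil => simp
    | cons y m ihm =>
      have ih₁ := ihl (y :: m)
      have ih₂ : mapChain (Prod.map f g) (cross (cone x (sgn (single l 1))) (single m 1)) =
          cross (mapChain f (cone x (sgn (single l 1)))) (mapChain g (single m 1)) := by
        rw [sgn_single]
        simp only [map_smul, cone_single, LinearMap.smul_apply, ihm]
      rw [← cone_single, ← cone_single] at *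
      set a := single l (1 : ℝ)
      set b := single m (1 : ℝ)
      simp only [cross_cone, mapChain_cone, map_add, map_smul, ih₁, ih₂, sgn_mapChain,
        coeffNil_mapChain, mapChain_single, List.map_nil, Prod.map_apply]

theorem cross_vertex_left (x : X) (m : List Y) (hm : m ≠ []) :
    cross (single [x] 1) (single m 1) = single (m.map fun y => (x, y)) (1 : ℝ) := by
  induction m with
  | nil => exact absurd rfl hm
  | cons y m ih =>
    cases m with
    | nil => simp [cross_single, crossList]
    | cons y' m =>
      have := cross_cone x y (single [] 1) (single (y' :: m) 1)
      simp only [sgn_single] at this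
      simp only [cone_single, cross_nil_left, List.length_nil, pow_zero, one_smul,
        coeffNil_cons, mul_zero, zero_smul, zero_add, add_zero] at this
      rw [this, ih (by simp)]
      simp

theorem cross_vertex_right (y : Y) (l : List X) (hl : l ≠ []) :
    cross (single l 1) (single [y] 1) = single (l.map fun x => (x, y)) (1 : ℝ) := by
  induction l with
  | nil => exact absurd rfl hl
  | cons x l ih =>
    cases l with
    | nil => simp [cross_single, crossList]
    | cons x' l =>
      have := cross_cone x y (single (x' :: l) 1) (single [] 1)
      simp only [cone_single, cross_nil_right, coeffNil_cons, zero_mul, zero_smul,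
        add_zero] at this
      rw [this, ih (by simp)]
      simp

theorem list_eq_map_finRange (l : List X) : l = (List.finRange l.length).map l.get := by
  simp

/-- By naturality, the product of two universal simplices bounds the norm of all products. -/
theorem exists_norm1_cross_le (p q : ℕ) : ∃ K : ℝ, 0 ≤ K ∧
    ∀ {X Y : Type*} (l : List X) (m : List Y), l.length = p → m.length = q →
      norm1 (cross (single l 1) (single m 1)) ≤ K := by
  refine ⟨norm1 (cross (single (List.finRange p) 1) (single (List.finRange q) 1)),
    norm1_nonneg _, ?_⟩
  rintro X Y l m rfl rfl
  have := mapChain_cross l.get m.get (single (List.finRange l.length) 1)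
    (single (List.finRange m.length) 1)
  rw [mapChain_single, mapChain_single, ← list_eq_map_finRange, ← list_eq_map_finRange] at this
  rw [← this]
  exact norm1_mapChain_le _ _

/-! ### The diagonal -/

/-- The Alexander–Whitney diagonal of a simplex: the sum over all vertices `v` of the face up to
and including `v`, tensor the face from `v` on. -/
noncomputable def awList : List X → ListChain X ⊗[ℝ] ListChain X
  | [] => 0
  | x :: l => single [x] (1 : ℝ) ⊗ₜ single (x :: l) (1 : ℝ) +
      TensorProduct.map (cone x) LinearMap.id (awList l)

/-- The linear extension of `awList`. -/
noncomputable def aw : ListChain X →ₗ[ℝ] ListChain X ⊗[ℝ] ListChain X :=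
  linearCombination ℝ awList

theorem aw_single (l : List X) : aw (single l 1) = awList l := by simp [aw]

theorem aw_cone (x : X) (c : ListChain X) :
    aw (cone x c) = single [x] (1 : ℝ) ⊗ₜ cone x c +
      TensorProduct.map (cone x) LinearMap.id (aw c) := by
  refine chain_ext (φ := aw ∘ₗ cone x) (ψ := TensorProduct.mk ℝ _ _ (single [x] (1 : ℝ)) ∘ₗ cone x +
    TensorProduct.map (cone x) LinearMap.id ∘ₗ aw) (fun l => ?_) c
  simp [aw_single, awList]

/-- The boundary of the tensor product of two complexes of simplices. The degree of a list is one
less than its length, whence the minus sign. -/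
noncomputable def tensorBd : ListChain X ⊗[ℝ] ListChain Y →ₗ[ℝ] ListChain X ⊗[ℝ] ListChain Y :=
  TensorProduct.map (bd (X := X)) (LinearMap.id (M := ListChain Y)) -
    TensorProduct.map (sgn (X := X)) (bd (X := Y))

theorem tensorBd_map_cone (x : X) (t : ListChain X ⊗[ℝ] ListChain Y) :
    tensorBd (TensorProduct.map (cone x) LinearMap.id t) =
      t - TensorProduct.map (cone x) LinearMap.id (tensorBd t) := by
  induction t with
  | zero => simp
  | add a b ha hb => simp only [map_add, ha, hb]; abel
  | tmul a b =>
    simp only [tensorBd, map_tmul, LinearMap.sub_apply, LinearMap.id_apply, bd_cone, sgn_cone,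
      map_sub, sub_tmul, neg_tmul]
    abel

/-- The Alexander–Whitney map is a chain map up to tensors with the empty simplex. -/
theorem tensorBd_aw (c : ListChain X) :
    tensorBd (aw c) = aw (bd c) + single [] (1 : ℝ) ⊗ₜ c - sgn c ⊗ₜ single [] (1 : ℝ) := by
  refine chain_ext (φ := tensorBd ∘ₗ aw) (ψ := aw (X := X) ∘ₗ bd +
    TensorProduct.mk ℝ (ListChain X) (ListChain X) (single [] (1 : ℝ)) -
    (TensorProduct.mk ℝ (ListChain X) (ListChain X)).flip (single [] (1 : ℝ)) ∘ₗ sgn)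
    (fun l => ?_) c
  simp only [LinearMap.comp_apply, LinearMap.add_apply, LinearMap.sub_apply, mk_apply,
    LinearMap.flip_apply]
  induction l with
  | nil => simp [aw_single, awList, sgn_single]
  | cons x l ih =>
    have h1 : tensorBd (single [x] (1 : ℝ) ⊗ₜ[ℝ] cone x (single l 1)) =
        single [] (1 : ℝ) ⊗ₜ cone x (single l 1) +
        single [x] (1 : ℝ) ⊗ₜ (single l 1 - cone x (bd (single l 1))) := by
      rw [← bd_cone]
      simp [tensorBd, bd_single [x], sgn_single [x], neg_tmul]
    rw [← cone_single, aw_cone, map_add, tensorBd_map_cone, ih, h1, bd_cone]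
    simp only [map_sub, map_add, aw_cone, map_tmul, cone_single x [], LinearMap.id_apply, sgn_cone,
      neg_tmul, tmul_sub]
    abel

theorem aw_mapChain (f : X → Y) (c : ListChain X) :
    aw (mapChain f c) = TensorProduct.map (mapChain f) (mapChain f) (aw c) := by
  refine chain_ext (φ := aw ∘ₗ mapChain f)
    (ψ := TensorProduct.map (mapChain f) (mapChain f) ∘ₗ aw) (fun l => ?_) c
  simp only [LinearMap.comp_apply]
  induction l with
  | nil => simp [aw_single, awList]
  | cons x l ih =>
    rw [← cone_single, mapChain_cone, aw_cone, aw_cone, ih, map_add, map_tmul, mapChain_cone]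
    congr 1
    · simp
    · rw [TensorProduct.map_map, TensorProduct.map_map]
      congr 2
      exact LinearMap.ext fun c => (mapChain_cone f x c).symm

/-! ### Homotopies -/

/-- A null-homotopy of a chain map `θ`, by recursion on the number of vertices: the part of the
homotopy equation that is already known is coned off from the image under `v` of the first vertex.
As no base point is chosen, the construction is natural. -/
noncomputable def coneHomotopyList (θ : ListChain X →ₗ[ℝ] ListChain Y) (v : X → Y) :
    List X → ListChain Y
  | [] => 0
  | x :: l => cone (v x) (θ (single (x :: l) 1) -
      ∑ j : Fin (l.length + 1), (-1 : ℝ) ^ (j : ℕ) •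
        coneHomotopyList θ v ((x :: l).eraseIdx j))
termination_by l => l.length
decreasing_by
  have := j.isLt
  rw [List.length_eraseIdx_of_lt (by simpa using this)]
  simp

/-- The linear extension of `coneHomotopyList`. -/
noncomputable def coneHomotopy (θ : ListChain X →ₗ[ℝ] ListChain Y) (v : X → Y) :
    ListChain X →ₗ[ℝ] ListChain Y :=
  linearCombination ℝ (coneHomotopyList θ v)

theorem coneHomotopy_nil (θ : ListChain X →ₗ[ℝ] ListChain Y) (v : X → Y) :
    coneHomotopy θ v (single [] 1) = 0 := by
  simp [coneHomotopy, coneHomotopyList]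

theorem coneHomotopy_cons (θ : ListChain X →ₗ[ℝ] ListChain Y) (v : X → Y) (x : X) (l : List X) :
    coneHomotopy θ v (single (x :: l) 1) =
      cone (v x) (θ (single (x :: l) 1) - coneHomotopy θ v (bd (single (x :: l) 1))) := by
  rw [bd_single, Finset.sum_range]
  simp [coneHomotopy, coneHomotopyList]

theorem bd_coneHomotopy {θ : ListChain X →ₗ[ℝ] ListChain Y} (v : X → Y)
    (hθ : ∀ c, bd (θ c) = θ (bd c)) (hnil : θ (single [] 1) = 0) (c : ListChain X) :
    bd (coneHomotopy θ v c) = θ c - coneHomotopy θ v (bd c) := by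
  refine chain_ext (φ := bd ∘ₗ coneHomotopy θ v) (ψ := θ - coneHomotopy θ v ∘ₗ bd)
    (fun l => ?_) c
  simp only [LinearMap.comp_apply, LinearMap.sub_apply]
  induction hn : l.length using Nat.strong_induction_on generalizing l with
  | _ n ih =>
    cases l with
    | nil => simp [coneHomotopy_nil, hnil]
    | cons x l =>
      have key : bd (coneHomotopy θ v (bd (single (x :: l) 1))) =
          θ (bd (single (x :: l) 1)) - coneHomotopy θ v (bd (bd (single (x :: l) 1))) := by
        rw [bd_single]
        simp only [map_sum, map_smul, ← Finset.sum_sub_distrib, ← smul_sub]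
        refine Finset.sum_congr rfl fun j hj => ?_
        have hj := Finset.mem_range.1 hj
        have hlen := List.length_eraseIdx_of_lt hj
        rw [ih _ _ _ rfl]
        rw [hlen, ← hn]
        omega
      rw [coneHomotopy_cons, bd_cone, map_sub, key, hθ, bd_bd]
      simp

theorem mapChain_coneHomotopy {θ : ListChain X →ₗ[ℝ] ListChain Y}
    {θ' : ListChain X' →ₗ[ℝ] ListChain Y'} {v : X → Y} {v' : X' → Y'} {f : X → X'} {g : Y → Y'}
    (hθ : ∀ c, mapChain g (θ c) = θ' (mapChain f c)) (hv : ∀ x, g (v x) = v' (f x))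
    (c : ListChain X) :
    mapChain g (coneHomotopy θ v c) = coneHomotopy θ' v' (mapChain f c) := by
  refine chain_ext (φ := mapChain g ∘ₗ coneHomotopy θ v) (ψ := coneHomotopy θ' v' ∘ₗ mapChain f)
    (fun l => ?_) c
  simp only [LinearMap.comp_apply]
  induction hn : l.length using Nat.strong_induction_on generalizing l with
  | _ n ih =>
    cases l with
    | nil => simp [coneHomotopy_nil]
    | cons x l =>
      have key : mapChain g (coneHomotopy θ v (bd (single (x :: l) 1))) =
          coneHomotopy θ' v' (bd (mapChain f (single (x :: l) 1))) := by
        rw [bd_mapChain, bd_single]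
        simp only [map_sum, map_smul]
        refine Finset.sum_congr rfl fun j hj => ?_
        have hj := Finset.mem_range.1 hj
        have hlen := List.length_eraseIdx_of_lt hj
        rw [ih _ _ _ rfl]
        rw [hlen, ← hn]
        omega
      rw [coneHomotopy_cons, mapChain_cone, map_sub, key, hθ, hv, mapChain_single, List.map_cons,
        coneHomotopy_cons]

/-- The difference of the chain map induced by the diagonal `X → X × X` and the composite of the
Alexander–Whitney map and the product. The last summand corrects this composite on the empty
simplex, where it is `0`, so that the difference is a chain map of augmented complexes. -/
noncomputable def diagError : ListChain X →ₗ[ℝ] ListChain (X × X) :=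
  mapChain (fun x => (x, x)) - TensorProduct.lift cross ∘ₗ aw -
    (LinearMap.toSpanSingleton ℝ _ (single [] 1)) ∘ₗ coeffNil

theorem bd_lift_cross (t : ListChain X ⊗[ℝ] ListChain Y) :
    bd (TensorProduct.lift cross t) = TensorProduct.lift cross (tensorBd t) +
      TensorProduct.lift ((LinearMap.mul ℝ ℝ).compl₁₂ (coeffNil ∘ₗ bd) (coeffNil ∘ₗ bd)) t •
        single [] 1 := by
  induction t with
  | zero => simp
  | add a b ha hb => simp only [map_add, ha, hb, add_smul]; abel
  | tmul a b => simp [bd_cross, tensorBd]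

/-- The first factors of the Alexander–Whitney diagonal are never empty. -/
theorem lift_coeffNil_aw (ψ : ListChain X →ₗ[ℝ] ℝ) (c : ListChain X) :
    TensorProduct.lift ((LinearMap.mul ℝ ℝ).compl₁₂ coeffNil ψ) (aw c) = 0 := by
  refine chain_ext (φ := TensorProduct.lift ((LinearMap.mul ℝ ℝ).compl₁₂ coeffNil ψ) ∘ₗ aw)
    (ψ := 0) (fun l => ?_) c
  cases l with
  | nil => simp [aw_single, awList]
  | cons x l =>
    have (t : ListChain X ⊗[ℝ] ListChain X) : TensorProduct.lift
        ((LinearMap.mul ℝ ℝ).compl₁₂ coeffNil ψ) (TensorProduct.map (cone x) LinearMap.id t) =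
        0 := by
      induction t with
      | zero => simp
      | add a b ha hb => simp only [map_add, ha, hb, add_zero]
      | tmul a b => simp
    simp [aw_single, awList, this]

/-- In the Alexander–Whitney diagonal, a tensor of two vertices occurs only in that of a vertex. -/
theorem augmentation_aw (c : ListChain X) :
    TensorProduct.lift ((LinearMap.mul ℝ ℝ).compl₁₂ (coeffNil ∘ₗ bd) (coeffNil ∘ₗ bd)) (aw c) =
      coeffNil (bd c) := by
  refine chain_ext (φ := TensorProduct.lift ((LinearMap.mul ℝ ℝ).compl₁₂ (coeffNil ∘ₗ bd)
    (coeffNil ∘ₗ bd)) ∘ₗ aw) (ψ := coeffNil ∘ₗ bd) (fun l => ?_) c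
  cases l with
  | nil => simp [aw_single, awList]
  | cons x l =>
    have (t : ListChain X ⊗[ℝ] ListChain X) : TensorProduct.lift
        ((LinearMap.mul ℝ ℝ).compl₁₂ (coeffNil ∘ₗ bd) (coeffNil ∘ₗ bd))
          (TensorProduct.map (cone x) LinearMap.id t) =
        TensorProduct.lift ((LinearMap.mul ℝ ℝ).compl₁₂ coeffNil (coeffNil ∘ₗ bd)) t := by
      induction t with
      | zero => simp
      | add a b ha hb => simp only [map_add, ha, hb]
      | tmul a b => simp [bd_cone]
    simp only [LinearMap.comp_apply]
    rw [← cone_single, aw_cone, map_add, this, lift_coeffNil_aw]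
    simp [bd_single [x]]

theorem bd_diagError (c : ListChain X) : bd (diagError c) = diagError (bd c) := by
  simp only [diagError, LinearMap.sub_apply, LinearMap.comp_apply, map_sub, bd_mapChain,
    bd_lift_cross, tensorBd_aw, augmentation_aw, map_add, TensorProduct.lift.tmul,
    cross_nil_left, cross_nil_right, LinearMap.toSpanSingleton_apply, map_smul, bd_nil]
  module

theorem diagError_nil : diagError (single ([] : List X) 1) = 0 := by
  simp [diagError, aw_single, awList]

theorem mapChain_diagError (f : X → Y) (c : ListChain X) :
    mapChain (Prod.map f f) (diagError c) = diagError (mapChain f c) := by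
  have h (t : ListChain X ⊗[ℝ] ListChain X) :
      mapChain (Prod.map f f) (TensorProduct.lift cross t) =
        TensorProduct.lift cross (TensorProduct.map (mapChain f) (mapChain f) t) := by
    induction t with
    | zero => simp
    | add a b ha hb => simp only [map_add, ha, hb]
    | tmul a b => simp [mapChain_cross]
  simp only [diagError, LinearMap.sub_apply, LinearMap.comp_apply, map_sub, h, aw_mapChain,
    mapChain_mapChain, LinearMap.toSpanSingleton_apply, map_smul, mapChain_single, List.map_nil,
    coeffNil_mapChain]
  rfl

/-- A natural homotopy between the diagonal and its Eilenberg–Zilber–Alexander–Whitney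
approximation. -/
noncomputable def diagHomotopy : ListChain X →ₗ[ℝ] ListChain (X × X) :=
  coneHomotopy diagError fun x => (x, x)

theorem bd_diagHomotopy (c : ListChain X) :
    bd (diagHomotopy c) = diagError c - diagHomotopy (bd c) :=
  bd_coneHomotopy _ bd_diagError diagError_nil c

theorem mapChain_diagHomotopy (f : X → Y) (c : ListChain X) :
    mapChain (Prod.map f f) (diagHomotopy c) = diagHomotopy (mapChain f c) :=
  mapChain_coneHomotopy (mapChain_diagError f) (fun _ => rfl) c

theorem exists_norm1_diagHomotopy_le (n : ℕ) : ∃ K : ℝ, 0 ≤ K ∧ ∀ {X : Type*} (l : List X),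
    l.length = n → norm1 (diagHomotopy (single l 1)) ≤ K := by
  refine ⟨norm1 (diagHomotopy (single (List.finRange n) 1)), norm1_nonneg _, ?_⟩
  rintro X l rfl
  have := mapChain_diagHomotopy l.get (single (List.finRange l.length) 1)
  rw [mapChain_single, ← list_eq_map_finRange] at this
  rw [← this]
  exact norm1_mapChain_le _ _

/-- A homotopy from the identity to the chain map induced by `r`: the alternating sum of the
simplices `x₀, …, xᵢ, r xᵢ, …, r xₖ`. -/
noncomputable def prismList (r : X → X) : List X → ListChain X
  | [] => 0
  | x :: l => cone x (single ((x :: l).map r) 1 - prismList r l)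

/-- The linear extension of `prismList`. -/
noncomputable def prism (r : X → X) : ListChain X →ₗ[ℝ] ListChain X :=
  linearCombination ℝ (prismList r)

theorem prism_cone (r : X → X) (x : X) (c : ListChain X) :
    prism r (cone x c) = cone x (mapChain r (cone x c) - prism r c) := by
  refine chain_ext (φ := prism r ∘ₗ cone x)
    (ψ := cone x ∘ₗ (mapChain r ∘ₗ cone x - prism r)) (fun l => ?_) c
  simp [prism, prismList]

theorem bd_prism (r : X → X) (c : ListChain X) :
    bd (prism r c) = mapChain r c - c - prism r (bd c) := by
  refine chain_ext (φ := bd ∘ₗ prism r)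
    (ψ := mapChain r - LinearMap.id - prism r ∘ₗ bd) (fun l => ?_) c
  simp only [LinearMap.comp_apply, LinearMap.sub_apply, LinearMap.id_apply]
  induction l with
  | nil => simp [prism, prismList]
  | cons x l ih =>
    rw [← cone_single, prism_cone, bd_cone]
    simp only [map_sub, bd_mapChain, bd_cone, ih, prism_cone]
    abel

theorem mapChain_prism {r : X → X} {r' : Y → Y} {f : X → Y} (h : ∀ x, f (r x) = r' (f x))
    (c : ListChain X) : mapChain f (prism r c) = prism r' (mapChain f c) := by
  have h' : f ∘ r = r' ∘ f := funext h
  refine chain_ext (φ := mapChain f ∘ₗ prism r) (ψ := prism r' ∘ₗ mapChain f) (fun l => ?_) c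
  simp only [LinearMap.comp_apply]
  induction l with
  | nil => simp [prism, prismList]
  | cons x l ih =>
    rw [← cone_single, prism_cone, mapChain_cone, map_sub, ih, mapChain_mapChain, h',
      ← mapChain_mapChain, mapChain_cone, prism_cone]

theorem norm1_prism_le (r : X → X) (l : List X) :
    norm1 (prism r (single l 1)) ≤ l.length := by
  induction l with
  | nil => simp [prism, prismList]
  | cons x l ih =>
    rw [← cone_single, prism_cone, cone_single, mapChain_single]
    refine (norm1_cone_le _ _).trans ((norm1_sub_le _ _).trans ?_)
    simp only [norm1_single, abs_one, List.length_cons, Nat.cast_add, Nat.cast_one]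
    linarith

end Simplices

section Bar
variable {A B C : Type*} [Group A] [Group B] [Group C]

/-! ### The bar complex as coinvariants of simplices -/

/-- The list of the quotients `vᵢ⁻¹ * vᵢ₊₁` of neighbouring vertices of the simplex `x :: l`. -/
def diffs : A → List A → List A
  | _, [] => []
  | x, y :: l => (x⁻¹ * y) :: diffs y l

/-- The simplex with first vertex `x` whose successive quotients are the entries of a given list.
-/
def walk : A → List A → List A
  | x, [] => [x]
  | x, g :: l => x :: walk (x * g) l

/-- The bar chain of a simplex, its class in the coinvariants. The empty simplex is sent to `0`. -/
noncomputable def toBarList : List A → ListChain A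
  | [] => 0
  | x :: l => single (diffs x l) 1

/-- The projection from simplices with vertices in a group to bar chains, the linear extension of
`toBarList`. -/
noncomputable def toBar : ListChain A →ₗ[ℝ] ListChain A := linearCombination ℝ toBarList

/-- The section of `toBar` which sends `g₁, …, gₖ` to the simplex `1, g₁, g₁ g₂, …, g₁ ⋯ gₖ`. -/
noncomputable def lift : ListChain A →ₗ[ℝ] ListChain A := lmapDomain ℝ ℝ (walk 1)

@[simp] theorem toBar_nil : toBar (single ([] : List A) (1 : ℝ)) = 0 := by
  simp [toBar, toBarList]

theorem toBar_cons (x : A) (l : List A) :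
    toBar (single (x :: l) (1 : ℝ)) = single (diffs x l) 1 := by
  simp [toBar, toBarList]

@[simp] theorem lift_single (l : List A) (r : ℝ) : lift (single l r) = single (walk 1 l) r := by
  simp [lift]

theorem walk_ne_nil (x : A) (l : List A) : walk x l ≠ [] := by
  cases l <;> simp [walk]

theorem length_walk (x : A) (l : List A) : (walk x l).length = l.length + 1 := by
  induction l generalizing x with
  | nil => rfl
  | cons g l ih => simp [walk, ih]

theorem length_diffs (x : A) (l : List A) : (diffs x l).length = l.length := by
  induction l generalizing x with
  | nil => rfl
  | cons g l ih => simp [diffs, ih]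

theorem toBar_walk (x : A) (l : List A) :
    toBar (single (walk x l) (1 : ℝ)) = single l 1 := by
  induction l generalizing x with
  | nil => simp [walk, toBar_cons, diffs]
  | cons g l ih =>
    have h := ih (x * g)
    cases l with
    | nil => simp [walk, toBar_cons, diffs]
    | cons g' l =>
      simp only [walk, toBar_cons, diffs] at h ⊢
      have h' := Finsupp.single_left_injective (one_ne_zero (α := ℝ)) h
      rw [h']
      simp

theorem walk_diffs (x : A) (l : List A) : walk x (diffs x l) = x :: l := by
  induction l generalizing x with
  | nil => rfl
  | cons g l ih => simp [diffs, walk, ih]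

theorem map_mul_walk (g x : A) (l : List A) : (walk x l).map (g * ·) = walk (g * x) l := by
  induction l generalizing x with
  | nil => rfl
  | cons h l ih => simp [walk, ih, mul_assoc]

theorem toBar_lift (c : ListChain A) : toBar (lift c) = c :=
  chain_ext (φ := toBar ∘ₗ lift) (ψ := LinearMap.id) (by simp [toBar_walk]) c

theorem map_walk (f : A →* B) (x : A) (l : List A) :
    (walk x l).map f = walk (f x) (l.map f) := by
  induction l generalizing x with
  | nil => rfl
  | cons h l ih => simp [walk, ih]

theorem map_diffs (f : A →* B) (x : A) (l : List A) :
    (diffs x l).map f = diffs (f x) (l.map f) := by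
  induction l generalizing x with
  | nil => rfl
  | cons h l ih => simp [diffs, ih]

theorem lift_mapChain (f : A →* B) (c : ListChain A) :
    lift (mapChain f c) = mapChain f (lift c) :=
  chain_ext (φ := lift ∘ₗ mapChain f) (ψ := mapChain f ∘ₗ lift) (by simp [map_walk]) c

theorem toBar_mapChain (f : A →* B) (c : ListChain A) :
    toBar (mapChain f c) = mapChain f (toBar c) := by
  refine chain_ext (φ := toBar ∘ₗ mapChain f) (ψ := mapChain f ∘ₗ toBar) (fun l => ?_) c
  cases l <;> simp [toBar_cons, map_diffs]

theorem toBar_mapChain_mul_left (g : A) (c : ListChain A) :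
    toBar (mapChain (g * ·) c) = toBar c := by
  refine chain_ext (φ := toBar ∘ₗ mapChain (g * ·)) (ψ := toBar) (fun l => ?_) c
  cases l with
  | nil => simp
  | cons x l =>
    rw [← walk_diffs x l, LinearMap.comp_apply, mapChain_single, map_mul_walk, toBar_walk,
      toBar_walk]

/-- A left invariant linear map that kills the empty simplex factors through the bar complex. -/
theorem apply_lift_toBar {V : Type*} [AddCommMonoid V] [Module ℝ V] (φ : ListChain A →ₗ[ℝ] V)
    (hnil : φ (single [] 1) = 0) (hφ : ∀ g c, φ (mapChain (g * ·) c) = φ c) (c : ListChain A) :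
    φ (lift (toBar c)) = φ c := by
  refine chain_ext (φ := φ ∘ₗ lift ∘ₗ toBar) (ψ := φ) (fun l => ?_) c
  cases l with
  | nil => simp [hnil]
  | cons x l =>
    have := hφ x (single (walk 1 (diffs x l)) 1)
    rw [mapChain_single, map_mul_walk, mul_one, walk_diffs] at this
    simp [toBar_cons, this]

theorem toBar_sgn (c : ListChain A) : toBar (sgn c) = -sgn (toBar c) := by
  refine chain_ext (φ := toBar ∘ₗ sgn) (ψ := -(sgn ∘ₗ toBar)) (fun l => ?_) c
  cases l with
  | nil => simp [sgn_single]
  | cons x l =>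
    simp only [LinearMap.comp_apply, sgn_single, map_smul, toBar_cons, LinearMap.neg_apply,
      length_diffs, List.length_cons, pow_succ]
    simp

/-- The boundary of the bar complex, induced by that of simplices; see `toListChain_barBoundary`
for the agreement with `barBoundary`. -/
noncomputable def barBd : ListChain A →ₗ[ℝ] ListChain A := toBar ∘ₗ bd ∘ₗ lift

theorem toBar_bd (c : ListChain A) : toBar (bd c) = barBd (toBar c) := by
  refine (apply_lift_toBar (toBar ∘ₗ bd) (by simp) (fun g c => ?_) c).symm
  simp [bd_mapChain, toBar_mapChain_mul_left]

theorem barBd_barBd (c : ListChain A) : barBd (barBd c) = 0 := by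
  have h : barBd c = toBar (bd (lift c)) := rfl
  rw [h, ← toBar_bd, bd_bd, map_zero]

theorem barBd_mapChain (f : A →* B) (c : ListChain A) :
    barBd (mapChain f c) = mapChain f (barBd c) := by
  simp [barBd, lift_mapChain, bd_mapChain, toBar_mapChain]

theorem sgn_barBd (c : ListChain A) : sgn (barBd c) = -barBd (sgn c) := by
  have h := toBar_sgn (bd (lift c))
  rw [sgn_bd, map_neg, toBar_bd, toBar_sgn, toBar_lift, toBar_bd, toBar_lift, map_neg,
    neg_neg] at h
  rw [h, neg_neg]

@[simp] theorem barBd_nil : barBd (single ([] : List A) (1 : ℝ)) = 0 := by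
  simp [barBd, walk, bd_single [(1 : A)]]

theorem barBd_single (l : List A) : barBd (single l 1) =
    ∑ j ∈ Finset.range (l.length + 1),
      (-1 : ℝ) ^ j • toBar (single ((walk 1 l).eraseIdx j) (1 : ℝ)) := by
  simp only [barBd, LinearMap.comp_apply, lift_single, bd_single, length_walk, map_sum, map_smul]

theorem norm1_toBar_le (c : ListChain A) : norm1 (toBar c) ≤ norm1 c := by
  simpa using norm1_map_le toBar 1 c (by rintro (_ | ⟨x, l⟩) _ <;> simp [toBar_cons])

theorem norm1_barBd_single_le (l : List A) : norm1 (barBd (single l 1)) ≤ l.length + 1 := by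
  rw [barBd_single]
  refine (norm1_sum_le _ _).trans ((Finset.sum_le_card_nsmul _ _ 1 fun j _ => ?_).trans ?_)
  · rw [norm1_smul]
    simpa using norm1_toBar_le (single ((walk 1 l).eraseIdx j) (1 : ℝ))
  · simp

/-- The chains supported on lists of length `n`, that is, the bar chains of degree `n`. -/
noncomputable def degree (X : Type*) (n : ℕ) : Submodule ℝ (ListChain X) :=
  Finsupp.supported ℝ ℝ {l | l.length = n}

theorem mem_degree {X : Type*} {n : ℕ} {c : ListChain X} :
    c ∈ degree X n ↔ ∀ l ∈ c.support, l.length = n := by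
  simp [degree, Finsupp.mem_supported, Set.subset_def]

theorem single_mem_degree {X : Type*} {n : ℕ} {l : List X} (h : l.length = n) (r : ℝ) :
    single l r ∈ degree X n := Finsupp.single_mem_supported ℝ r h

theorem map_mem_of_mem_degree {X V : Type*} [AddCommMonoid V] [Module ℝ V]
    {L : ListChain X →ₗ[ℝ] V} {n : ℕ} {S : Submodule ℝ V}
    (h : ∀ l : List X, l.length = n → L (single l 1) ∈ S) {c : ListChain X}
    (hc : c ∈ degree X n) : L c ∈ S := by
  rw [← Finsupp.sum_single c, Finsupp.sum, map_sum]
  refine Submodule.sum_mem _ fun l hl => ?_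
  rw [← mul_one (c l), ← smul_eq_mul, ← Finsupp.smul_single, map_smul]
  exact S.smul_mem _ (h l (mem_degree.1 hc l hl))

theorem map_eq_of_mem_degree {X V : Type*} [AddCommGroup V] [Module ℝ V]
    {L L' : ListChain X →ₗ[ℝ] V} {n : ℕ}
    (h : ∀ l : List X, l.length = n → L (single l 1) = L' (single l 1)) {c : ListChain X}
    (hc : c ∈ degree X n) : L c = L' c := by
  have := map_mem_of_mem_degree (L := L - L') (S := ⊥) (n := n)
    (fun l hl => by simp [h l hl]) hc
  simpa [sub_eq_zero] using this

theorem norm1_map_le_of_mem_degree {X Y : Type*} {L : ListChain X →ₗ[ℝ] (Y →₀ ℝ)} {n : ℕ} {K : ℝ}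
    (h : ∀ l : List X, l.length = n → norm1 (L (single l 1)) ≤ K) {c : ListChain X}
    (hc : c ∈ degree X n) : norm1 (L c) ≤ K * norm1 c :=
  norm1_map_le L K c fun l hl => h l (mem_degree.1 hc l hl)

theorem barBd_mem_degree {n : ℕ} {c : ListChain A} (hc : c ∈ degree A (n + 1)) :
    barBd c ∈ degree A n := by
  refine map_mem_of_mem_degree (fun l hl => ?_) hc
  rw [barBd_single]
  refine Submodule.sum_mem _ fun j hj => Submodule.smul_mem _ _ ?_
  have hlen : ((walk 1 l).eraseIdx j).length = n + 1 := by
    rw [List.length_eraseIdx_of_lt (by simpa [length_walk] using hj), length_walk, hl]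
    simp
  cases he : (walk 1 l).eraseIdx j with
  | nil => simp
  | cons x m =>
    rw [toBar_cons]
    refine single_mem_degree ?_ _
    rw [he] at hlen
    simpa [length_diffs] using hlen

/-- The projection to the component of degree `n`. -/
noncomputable def degreeProj (X : Type*) (n : ℕ) : ListChain X →ₗ[ℝ] ListChain X :=
  linearCombination ℝ fun l : List X => if l.length = n then single l 1 else 0

theorem degreeProj_of_mem {X : Type*} {n : ℕ} {c : ListChain X} (hc : c ∈ degree X n) :
    degreeProj X n c = c :=
  map_eq_of_mem_degree (L' := LinearMap.id) (fun l hl => by simp [degreeProj, hl]) hc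

theorem degreeProj_of_mem_ne {X : Type*} {n m : ℕ} (hne : m ≠ n) {c : ListChain X}
    (hc : c ∈ degree X m) : degreeProj X n c = 0 :=
  map_eq_of_mem_degree (L' := 0) (fun l hl => by simp [degreeProj, hl, hne]) hc

theorem degreeProj_mem {X : Type*} (n : ℕ) (c : ListChain X) : degreeProj X n c ∈ degree X n := by
  rw [← Finsupp.sum_single c, Finsupp.sum, map_sum]
  refine Submodule.sum_mem _ fun l _ => ?_
  by_cases h : l.length = n
  · rw [degreeProj_of_mem (single_mem_degree h _)]
    exact single_mem_degree h _
  · rw [degreeProj_of_mem_ne h (single_mem_degree rfl _)]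
    exact zero_mem _

theorem norm1_degreeProj_le {X : Type*} (n : ℕ) (c : ListChain X) :
    norm1 (degreeProj X n c) ≤ norm1 c := by
  refine (norm1_map_le _ 1 c fun l _ => ?_).trans (one_mul _).le
  by_cases h : l.length = n <;> simp [degreeProj, h]

theorem barBd_degreeProj (n : ℕ) (c : ListChain A) :
    barBd (degreeProj A (n + 1) c) = degreeProj A n (barBd c) := by
  suffices h : ∀ l : List A, (barBd ∘ₗ degreeProj A (n + 1)) (single l 1) =
      (degreeProj A n ∘ₗ barBd) (single l 1) from chain_ext h c
  intro l
  simp only [LinearMap.comp_apply]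
  by_cases h : l.length = n + 1
  · rw [degreeProj_of_mem (single_mem_degree h _),
      degreeProj_of_mem (barBd_mem_degree (single_mem_degree h _))]
  · rw [degreeProj_of_mem_ne h (single_mem_degree rfl _), map_zero]
    cases l with
    | nil => simp
    | cons g l =>
      rw [degreeProj_of_mem_ne (m := l.length) (by simpa using h)
        (barBd_mem_degree (single_mem_degree rfl _))]

theorem coeffNil_eq_zero {n : ℕ} {X : Type*} {c : ListChain X} (hc : c ∈ degree X (n + 1)) :
    coeffNil c = 0 :=
  map_eq_of_mem_degree (L' := 0) (fun l hl => by cases l <;> simp_all) hc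

theorem coeffNil_barBd (c : ListChain A) : coeffNil (barBd c) = 0 := by
  refine chain_ext (φ := coeffNil ∘ₗ barBd) (ψ := 0) (fun l => ?_) c
  cases l with
  | nil => simp
  | cons g l =>
    cases l with
    | nil => simp [barBd, bd_single, walk, Finset.sum_range_succ, toBar_cons, diffs]
    | cons g' l =>
      exact coeffNil_eq_zero (barBd_mem_degree (n := l.length + 1) (single_mem_degree rfl 1))

/-! ### Cross product and diagonal of bar chains -/

/-- The product of bar chains of two groups, a bar chain of the product group. -/
noncomputable def barCross : ListChain A →ₗ[ℝ] ListChain B →ₗ[ℝ] ListChain (A × B) :=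
  (cross.compl₁₂ lift lift).compr₂ toBar

/-- The product of simplices descends to bar chains, as it is equivariant for both groups. -/
theorem toBar_cross (a : ListChain A) (b : ListChain B) :
    toBar (cross a b) = barCross (toBar a) (toBar b) := by
  have h₁ : toBar (cross (lift (toBar a)) (lift (toBar b))) =
      toBar (cross a (lift (toBar b))) := by
    refine apply_lift_toBar (toBar ∘ₗ cross.flip (lift (toBar b))) (by simp) (fun g c => ?_) a
    have := toBar_mapChain_mul_left ((g, 1) : A × B) (cross c (lift (toBar b)))
    have e : (((g, 1) : A × B) * ·) = Prod.map (g * ·) id := by ext x <;> simp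
    rw [e, mapChain_cross, mapChain_id] at this
    exact this
  have h₂ : toBar (cross a (lift (toBar b))) = toBar (cross a b) := by
    refine apply_lift_toBar (toBar ∘ₗ cross a) (by simp) (fun g c => ?_) b
    have := toBar_mapChain_mul_left ((1, g) : A × B) (cross a c)
    have e : (((1, g) : A × B) * ·) = Prod.map id (g * ·) := by ext x <;> simp
    rw [e, mapChain_cross, mapChain_id] at this
    exact this
  rw [← h₂, ← h₁]
  rfl

theorem barBd_barCross (a : ListChain A) (b : ListChain B) :
    barBd (barCross a b) = barCross (barBd a) b + barCross (sgn a) (barBd b) := by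
  have h : barCross a b = toBar (cross (lift a) (lift b)) := rfl
  rw [h, ← toBar_bd, bd_cross]
  simp only [map_add, map_sub, map_smul, toBar_cross, toBar_bd, toBar_lift, toBar_sgn, toBar_nil,
    map_neg, LinearMap.neg_apply, smul_zero, add_zero, sub_neg_eq_add]

theorem barCross_nil_left (b : ListChain B) :
    barCross (single ([] : List A) 1) b = mapChain (MonoidHom.inr A B) b := by
  refine chain_ext (ψ := mapChain (MonoidHom.inr A B)) (fun m => ?_) b
  have h : barCross (single ([] : List A) 1) (single m 1) =
    toBar (cross (lift (single ([] : List A) 1)) (lift (single m 1))) := rfl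
  have e : (fun y : B => ((1 : A), y)) = MonoidHom.inr A B := rfl
  rw [h, lift_single, lift_single, walk, cross_vertex_left _ _ (walk_ne_nil _ _), e, map_walk,
    toBar_walk, mapChain_single]

theorem barCross_nil_right (a : ListChain A) :
    barCross a (single ([] : List B) 1) = mapChain (MonoidHom.inl A B) a := by
  refine chain_ext (φ := barCross.flip (single ([] : List B) 1))
    (ψ := mapChain (MonoidHom.inl A B)) (fun m => ?_) a
  have h : barCross (single m 1) (single ([] : List B) 1) =
    toBar (cross (lift (single m 1)) (lift (single ([] : List B) 1))) := rfl
  have e : (fun x : A => (x, (1 : B))) = MonoidHom.inl A B := rfl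
  rw [LinearMap.flip_apply, h, lift_single, lift_single, walk,
    cross_vertex_right _ _ (walk_ne_nil _ _), e, map_walk, toBar_walk, mapChain_single]

theorem exists_norm1_barCross_le (p q : ℕ) : ∃ K : ℝ, 0 ≤ K ∧
    ∀ {A B : Type*} [Group A] [Group B] (a : ListChain A) (b : ListChain B),
    a ∈ degree A p → b ∈ degree B q → norm1 (barCross a b) ≤ K * norm1 a * norm1 b := by
  obtain ⟨K, hK, h⟩ := exists_norm1_cross_le (p + 1) (q + 1)
  refine ⟨K, hK, ?_⟩
  intro A B _ _ a b ha hb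
  have h' : ∀ l : List A, l.length = p → norm1 (barCross (single l 1) b) ≤ K * norm1 b := by
    intro l hl
    refine norm1_map_le_of_mem_degree (fun m hm => ?_) hb
    have e : barCross (single l 1) (single m 1) =
      toBar (cross (lift (single l 1)) (lift (single m 1))) := rfl
    rw [e, lift_single, lift_single]
    exact (norm1_toBar_le _).trans (h _ _ (by simp [length_walk, hl]) (by simp [length_walk, hm]))
  have := norm1_map_le_of_mem_degree (L := barCross.flip b) h' ha
  calc _ ≤ _ := this
    _ = _ := by ring

/-- The boundary of the tensor product of two bar complexes. -/
noncomputable def barTensorBd : ListChain A ⊗[ℝ] ListChain B →ₗ[ℝ] ListChain A ⊗[ℝ] ListChain B :=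
  TensorProduct.map (barBd (A := A)) (LinearMap.id (M := ListChain B)) +
    TensorProduct.map (sgn (X := A)) (barBd (A := B))

theorem barBd_lift_barCross (t : ListChain A ⊗[ℝ] ListChain B) :
    barBd (TensorProduct.lift barCross t) = TensorProduct.lift barCross (barTensorBd t) := by
  induction t with
  | zero => simp
  | add a b ha hb => simp only [map_add, ha, hb]
  | tmul a b => simp [barTensorBd, barBd_barCross]

theorem map_barTensorBd (f : A →* B) (t : ListChain A ⊗[ℝ] ListChain A) :
    TensorProduct.map (mapChain f) (mapChain f) (barTensorBd t) =
      barTensorBd (TensorProduct.map (mapChain f) (mapChain f) t) := by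
  induction t with
  | zero => simp
  | add a b ha hb => simp only [map_add, ha, hb]
  | tmul a b => simp [barTensorBd, barBd_mapChain, sgn_mapChain]

/-- The Alexander–Whitney diagonal of the bar complex; it is deconcatenation of lists by
`barDiag_single`. -/
noncomputable def barDiag : ListChain A →ₗ[ℝ] ListChain A ⊗[ℝ] ListChain A :=
  TensorProduct.map toBar toBar ∘ₗ aw ∘ₗ lift

theorem map_toBar_aw (c : ListChain A) :
    TensorProduct.map toBar toBar (aw c) = barDiag (toBar c) := by
  refine (apply_lift_toBar (TensorProduct.map toBar toBar ∘ₗ aw) (by simp [aw_single, awList])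
    (fun g c => ?_) c).symm
  have e : toBar ∘ₗ mapChain (g * ·) = (toBar : ListChain A →ₗ[ℝ] ListChain A) :=
    LinearMap.ext (toBar_mapChain_mul_left g)
  rw [LinearMap.comp_apply, aw_mapChain, TensorProduct.map_map, e]
  rfl

theorem barTensorBd_barDiag (c : ListChain A) : barTensorBd (barDiag c) = barDiag (barBd c) := by
  have h (t : ListChain A ⊗[ℝ] ListChain A) : barTensorBd (TensorProduct.map toBar toBar t) =
      TensorProduct.map toBar toBar (tensorBd t) := by
    induction t with
    | zero => simp
    | add a b ha hb => simp only [map_add, ha, hb]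
    | tmul a b => simp [barTensorBd, tensorBd, toBar_bd, toBar_sgn, neg_tmul]
  have h' : barDiag c = TensorProduct.map toBar toBar (aw (lift c)) := rfl
  rw [h', h, tensorBd_aw]
  simp only [map_sub, map_add, map_tmul, toBar_nil, zero_tmul, tmul_zero, add_zero, sub_zero,
    map_toBar_aw]
  rfl

theorem toBar_cone_cone (x y : A) (c : ListChain A) :
    toBar (cone x (cone y c)) = cone (x⁻¹ * y) (toBar (cone y c)) :=
  chain_ext (φ := toBar ∘ₗ cone x ∘ₗ cone y) (ψ := cone (x⁻¹ * y) ∘ₗ toBar ∘ₗ cone y)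
    (by simp [toBar_cons, diffs]) c

theorem map_toBar_cone_awList_walk (x y : A) (l : List A) :
    TensorProduct.map (toBar ∘ₗ cone x) toBar (awList (walk y l)) =
      TensorProduct.map (cone (x⁻¹ * y)) LinearMap.id
        (TensorProduct.map toBar toBar (awList (walk y l))) := by
  have key (m : List A) : TensorProduct.map (toBar ∘ₗ cone x) toBar (awList (y :: m)) =
      TensorProduct.map (cone (x⁻¹ * y)) LinearMap.id
        (TensorProduct.map toBar toBar (awList (y :: m))) := by
    have e : toBar ∘ₗ cone x ∘ₗ cone y = cone (x⁻¹ * y) ∘ₗ toBar ∘ₗ cone y :=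
      LinearMap.ext (toBar_cone_cone x y)
    simp only [awList, map_add, map_tmul, TensorProduct.map_map, LinearMap.comp_assoc, e]
    simp [toBar_cons, diffs]
  cases l <;> exact key _

theorem barDiag_cons (g : A) (l : List A) :
    barDiag (single (g :: l) 1) = single [] (1 : ℝ) ⊗ₜ single (g :: l) (1 : ℝ) +
      TensorProduct.map (cone g) LinearMap.id (barDiag (single l 1)) := by
  have h : barDiag (single l 1) = TensorProduct.map toBar toBar (awList (walk g l)) := by
    rw [← aw_single, map_toBar_aw, toBar_walk]
  have h' : barDiag (single (g :: l) 1) =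
      TensorProduct.map toBar toBar (awList (walk 1 (g :: l))) := by
    rw [← aw_single, map_toBar_aw, toBar_walk]
  have h'' := map_toBar_cone_awList_walk 1 g l
  rw [h, h']
  rw [inv_one, one_mul] at h''
  rw [← h'']
  have e : walk 1 (g :: l) = 1 :: walk g l := by simp [walk]
  simp only [e, awList, map_add, map_tmul, TensorProduct.map_map, LinearMap.comp_id]
  rw [← e, toBar_walk]
  simp [toBar_cons, diffs]

theorem barDiag_single (l : List A) : barDiag (single l 1) =
    ∑ i ∈ Finset.range (l.length + 1), single (l.take i) (1 : ℝ) ⊗ₜ single (l.drop i) (1 : ℝ) := by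
  induction l with
  | nil =>
    simp [barDiag, walk, aw_single, awList, toBar_cons, diffs]
  | cons g l ih =>
    rw [barDiag_cons, ih, List.length_cons, Finset.sum_range_succ' _ (l.length + 1), add_comm]
    simp only [map_sum, map_tmul, cone_single, LinearMap.id_apply, List.take_succ_cons,
      List.drop_succ_cons, List.take_zero, List.drop_zero]

/-- The diagonal without the two summands in which one factor is empty. The last summand makes it
vanish on the empty list, where these two coincide. -/
noncomputable def reducedDiag : ListChain A →ₗ[ℝ] ListChain A ⊗[ℝ] ListChain A :=
  barDiag - TensorProduct.mk ℝ (ListChain A) (ListChain A) (single [] (1 : ℝ)) -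
    (TensorProduct.mk ℝ (ListChain A) (ListChain A)).flip (single [] (1 : ℝ)) +
    LinearMap.toSpanSingleton ℝ _ (single [] (1 : ℝ) ⊗ₜ single [] (1 : ℝ)) ∘ₗ coeffNil

theorem reducedDiag_apply (c : ListChain A) : reducedDiag c = barDiag c -
    single [] (1 : ℝ) ⊗ₜ c - c ⊗ₜ single [] (1 : ℝ) +
      coeffNil c • single [] (1 : ℝ) ⊗ₜ single [] (1 : ℝ) := rfl

theorem reducedDiag_single (l : List A) (hl : l ≠ []) : reducedDiag (single l 1) =
    ∑ i ∈ Finset.range (l.length - 1),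
      single (l.take (i + 1)) (1 : ℝ) ⊗ₜ single (l.drop (i + 1)) (1 : ℝ) := by
  cases l with
  | nil => exact absurd rfl hl
  | cons g l =>
    rw [reducedDiag_apply, barDiag_single, List.length_cons, Finset.sum_range_succ',
      Finset.sum_range_succ, coeffNil_cons]
    simp

theorem barTensorBd_reducedDiag (c : ListChain A) :
    barTensorBd (reducedDiag c) = reducedDiag (barBd c) := by
  rw [reducedDiag_apply, reducedDiag_apply, map_add, map_sub, map_sub, barTensorBd_barDiag,
    coeffNil_barBd]
  simp [barTensorBd, sgn_single ([] : List A)]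

theorem reducedDiag_mapChain (f : A →* B) (c : ListChain A) :
    reducedDiag (mapChain f c) =
      TensorProduct.map (mapChain f) (mapChain f) (reducedDiag c) := by
  refine chain_ext (φ := reducedDiag ∘ₗ mapChain f)
    (ψ := TensorProduct.map (mapChain f) (mapChain f) ∘ₗ reducedDiag) (fun l => ?_) c
  simp only [LinearMap.comp_apply, reducedDiag_apply, barDiag_single, mapChain_single, map_add,
    map_sub, map_smul, map_sum, map_tmul, List.length_map, List.map_take, List.map_drop,
    List.map_nil]
  cases l <;> simp

/-! ### Homotopies on the bar complex -/

/-- The homotopy `diagHomotopy` on bar chains. -/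
noncomputable def barDiagHomotopy : ListChain A →ₗ[ℝ] ListChain (A × A) :=
  toBar ∘ₗ diagHomotopy ∘ₗ lift

theorem barBd_barDiagHomotopy (c : ListChain A) :
    barBd (barDiagHomotopy c) = mapChain (fun x => (x, x)) c -
      TensorProduct.lift barCross (barDiag c) - barDiagHomotopy (barBd c) := by
  have h (t : ListChain A ⊗[ℝ] ListChain A) : toBar (TensorProduct.lift cross t) =
      TensorProduct.lift barCross (TensorProduct.map toBar toBar t) := by
    induction t with
    | zero => simp
    | add a b ha hb => simp only [map_add, ha, hb]
    | tmul a b => simp [toBar_cross]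
  have h₂ (c : ListChain A) : toBar (diagHomotopy c) = barDiagHomotopy (toBar c) := by
    refine (apply_lift_toBar (toBar ∘ₗ diagHomotopy) ?_ (fun g c => ?_) c).symm
    · simp [diagHomotopy, coneHomotopy_nil]
    · have := toBar_mapChain_mul_left ((g, g) : A × A) (diagHomotopy c)
      have e : (((g, g) : A × A) * ·) = Prod.map (g * ·) (g * ·) := by ext x <;> simp
      rw [e, mapChain_diagHomotopy] at this
      exact this
  have h₃ : mapChain (fun x => (x, x)) (lift c) = mapChain ((MonoidHom.id A).prod (MonoidHom.id A))
    (lift c) := rfl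
  have h₄ : barDiagHomotopy c = toBar (diagHomotopy (lift c)) := rfl
  rw [h₄, ← toBar_bd, bd_diagHomotopy, map_sub, h₂, toBar_bd, toBar_lift]
  simp only [diagError, LinearMap.sub_apply, LinearMap.comp_apply, map_sub, h, h₃, toBar_mapChain,
    toBar_lift, map_toBar_aw, LinearMap.toSpanSingleton_apply, map_smul, toBar_nil,
    smul_zero, sub_zero]
  rfl

theorem exists_norm1_barDiagHomotopy_le (n : ℕ) : ∃ K : ℝ, 0 ≤ K ∧
    ∀ {A : Type*} [Group A] (c : ListChain A), c ∈ degree A n →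
      norm1 (barDiagHomotopy c) ≤ K * norm1 c := by
  obtain ⟨K, hK, h⟩ := exists_norm1_diagHomotopy_le (n + 1)
  refine ⟨K, hK, fun c hc => norm1_map_le_of_mem_degree (fun l hl => ?_) hc⟩
  refine (norm1_toBar_le _).trans ?_
  rw [LinearMap.comp_apply, lift_single]
  exact h _ (by simp [length_walk, hl])

/-- A homotopy between the identity and conjugation by `s` on bar chains. On simplices, conjugation
lifts to right multiplication of the vertices by `s⁻¹`, and `prism` applies. -/
noncomputable def conjHomotopy (s : A) : ListChain A →ₗ[ℝ] ListChain A :=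
  toBar ∘ₗ prism (· * s⁻¹) ∘ₗ lift

theorem diffs_map_mul_right (s x : A) (l : List A) :
    diffs (x * s⁻¹) (l.map (· * s⁻¹)) = (diffs x l).map fun g => s * g * s⁻¹ := by
  induction l generalizing x with
  | nil => rfl
  | cons y l ih => simp [diffs, ih, mul_assoc]

theorem barBd_conjHomotopy (s : A) (c : ListChain A) :
    barBd (conjHomotopy s c) =
      mapChain (fun g => s * g * s⁻¹) c - c - conjHomotopy s (barBd c) := by
  have h₁ (c : ListChain A) : toBar (mapChain (· * s⁻¹) c) =
      mapChain (fun g => s * g * s⁻¹) (toBar c) := by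
    refine chain_ext (φ := toBar ∘ₗ mapChain (· * s⁻¹))
      (ψ := mapChain (fun g => s * g * s⁻¹) ∘ₗ toBar) (fun l => ?_) c
    cases l <;> simp [toBar_cons, diffs_map_mul_right]
  have h₂ (c : ListChain A) : toBar (prism (· * s⁻¹) c) = conjHomotopy s (toBar c) := by
    refine (apply_lift_toBar (toBar ∘ₗ prism (· * s⁻¹)) ?_ (fun g c => ?_) c).symm
    · simp [prism, prismList]
    · have := toBar_mapChain_mul_left g (prism (· * s⁻¹) c)
      rw [mapChain_prism (r' := (· * s⁻¹)) (fun x => (mul_assoc _ _ _).symm)] at this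
      exact this
  have h₃ : conjHomotopy s c = toBar (prism (· * s⁻¹) (lift c)) := rfl
  rw [h₃, ← toBar_bd, bd_prism]
  simp [h₁, h₂, toBar_lift, toBar_bd]

theorem norm1_conjHomotopy_le (s : A) {n : ℕ} {c : ListChain A} (hc : c ∈ degree A n) :
    norm1 (conjHomotopy s c) ≤ (n + 1) * norm1 c := by
  refine norm1_map_le_of_mem_degree (fun l hl => ?_) hc
  have h : conjHomotopy s (single l 1) = toBar (prism (· * s⁻¹) (lift (single l 1))) := rfl
  rw [h, lift_single]
  refine (norm1_toBar_le _).trans ((norm1_prism_le _ _).trans ?_)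
  simp [length_walk, hl]

end Bar

section UniformBoundary
variable {G : Type*} [Group G]

theorem mapChain_mem_degree {X Y : Type*} (f : X → Y) {n : ℕ} {c : ListChain X}
    (hc : c ∈ degree X n) : mapChain f c ∈ degree Y n :=
  map_mem_of_mem_degree (fun l hl => by
    rw [mapChain_single]
    exact single_mem_degree (by simpa using hl) _) hc

theorem mapChain_eq_self {X : Type*} {f : X → X} {c : ListChain X}
    (h : ∀ l ∈ c.support, ∀ x ∈ l, f x = x) : mapChain f c = c := by
  conv_lhs => rw [← Finsupp.sum_single c, Finsupp.sum, map_sum]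
  conv_rhs => rw [← Finsupp.sum_single c, Finsupp.sum]
  refine Finset.sum_congr rfl fun l hl => ?_
  rw [mapChain_single, List.map_congr_left (g := id) (h l hl), List.map_id]

/-! ### Uniform boundary condition -/

/-- The uniform boundary condition in degree `n`: cycles bound, with a linear bound on the norm of
the filling. -/
def UniformBoundary (G : Type*) [Group G] (n : ℕ) : Prop :=
  ∃ K : ℝ, ∀ z ∈ degree G n, barBd z = 0 →
    ∃ b ∈ degree G (n + 1), barBd b = z ∧ norm1 b ≤ K * norm1 z

/-- The operator `h` raises degrees by `1`, is bounded by `K` on lists, and is a contracting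
homotopy of the bar complex in the degrees `1, …, n`. In degree `0` it is one up to the empty list,
which spans the homology there. -/
structure IsContraction (h : ListChain G →ₗ[ℝ] ListChain G) (K : ℝ) (n : ℕ) : Prop where
  barBd_add : ∀ l : List G, l.length ≤ n → barBd (h (single l 1)) + h (barBd (single l 1)) =
    single l 1 - coeffNil (single l 1) • single [] 1
  map_mem_degree : ∀ l : List G, h (single l 1) ∈ degree G (l.length + 1)
  norm1_le : ∀ l : List G, norm1 (h (single l 1)) ≤ K

/-- The operator is built degree by degree: its value on a list `l` of the next degree is a filling
of the cycle `l - h ∂ l`. -/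
theorem exists_isContraction (n : ℕ) (hn : ∀ m, 0 < m → m ≤ n → UniformBoundary G m) :
    ∃ (h : ListChain G →ₗ[ℝ] ListChain G) (K : ℝ), IsContraction h K n := by
  induction n with
  | zero =>
    refine ⟨0, 0, fun l hl => ?_, fun l => zero_mem _, fun l => by simp⟩
    rw [List.eq_nil_of_length_eq_zero (Nat.le_zero.1 hl)]
    simp
  | succ n ih =>
    obtain ⟨h, K, hh⟩ := ih fun m h0 hm => hn m h0 (hm.trans n.le_succ)
    obtain ⟨K', hK'⟩ := hn (n + 1) n.succ_pos le_rfl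
    have hK : 0 ≤ K := (norm1_nonneg _).trans (hh.norm1_le [])
    have hdeg (l : List G) (hl : l.length = n + 1) : barBd (single l 1) ∈ degree G n :=
      barBd_mem_degree (single_mem_degree hl 1)
    have hfill (l : List G) : ∃ b, l.length = n + 1 → b ∈ degree G (n + 1 + 1) ∧
        barBd b = single l 1 - h (barBd (single l 1)) ∧
        norm1 b ≤ |K'| * (1 + K * (n + 2)) := by
      by_cases hl : l.length = n + 1
      swap
      · exact ⟨0, fun hl' => absurd hl' hl⟩
      have hb : norm1 (h (barBd (single l 1))) ≤ K * (n + 2) := by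
        refine (norm1_map_le h K _ fun m _ => hh.norm1_le m).trans ?_
        refine mul_le_mul_of_nonneg_left ((norm1_barBd_single_le l).trans ?_) hK
        rw [hl]
        push_cast
        linarith
      have hcontr : barBd (h (barBd (single l 1))) = barBd (single l 1) := by
        have := map_eq_of_mem_degree (L := barBd ∘ₗ h + h ∘ₗ barBd)
          (L' := LinearMap.id - LinearMap.toSpanSingleton ℝ _ (single [] 1) ∘ₗ coeffNil)
          (fun m hm => hh.barBd_add m hm.le) (hdeg l hl)
        simpa [barBd_barBd, coeffNil_barBd] using this
      obtain ⟨b, hb₁, hb₂, hb₃⟩ := hK' (single l 1 - h (barBd (single l 1)))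
        (Submodule.sub_mem _ (single_mem_degree hl 1)
          (map_mem_of_mem_degree (fun m hm => hm ▸ hh.map_mem_degree m) (hdeg l hl)))
        (by rw [map_sub, hcontr, sub_self])
      refine ⟨b, fun _ => ⟨hb₁, hb₂, hb₃.trans ?_⟩⟩
      refine (mul_le_mul_of_nonneg_right (le_abs_self K') (norm1_nonneg _)).trans ?_
      refine mul_le_mul_of_nonneg_left ((norm1_sub_le _ _).trans ?_) (abs_nonneg _)
      rw [norm1_single, abs_one]
      linarith
    choose F hF using hfill
    have hnew (l : List G) : linearCombination ℝ
        (fun l : List G => if l.length = n + 1 then F l else h (single l 1)) (single l 1) =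
        if l.length = n + 1 then F l else h (single l 1) := by simp
    refine ⟨linearCombination ℝ
        fun l : List G => if l.length = n + 1 then F l else h (single l 1),
      max K (|K'| * (1 + K * (n + 2))), fun l hl => ?_, fun l => ?_, fun l => ?_⟩
    · have hold : linearCombination ℝ
          (fun l : List G => if l.length = n + 1 then F l else h (single l 1))
          (barBd (single l 1)) = h (barBd (single l 1)) := by
        cases l with
        | nil => simp
        | cons g l =>
          refine map_eq_of_mem_degree (n := l.length) (fun m hm => ?_)
            (barBd_mem_degree (single_mem_degree rfl 1))
          rw [hnew, if_neg]
          rw [List.length_cons] at hl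
          omega
      rw [hold, hnew]
      split_ifs with hl'
      · rw [(hF l hl').2.1, coeffNil_eq_zero (single_mem_degree hl' 1)]
        simp
      · exact hh.barBd_add l (by omega)
    · rw [hnew]
      split_ifs with hl'
      · rw [hl']
        exact (hF l hl').1
      · exact hh.map_mem_degree l
    · rw [hnew]
      split_ifs with hl'
      · exact (hF l hl').2.2.trans (le_max_right _ _)
      · exact (hh.norm1_le l).trans (le_max_left _ _)

/-- The homotopy on a tensor product that is induced by a homotopy on the second factor. -/
theorem barTensorBd_map_sgn (h : ListChain G →ₗ[ℝ] ListChain G)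
    (t : ListChain G ⊗[ℝ] ListChain G) :
    barTensorBd (TensorProduct.map sgn h t) + TensorProduct.map sgn h (barTensorBd t) =
      TensorProduct.map LinearMap.id (barBd ∘ₗ h + h ∘ₗ barBd) t := by
  induction t with
  | zero => simp
  | add a b ha hb =>
    simp only [map_add, ← ha, ← hb]
    abel
  | tmul a b =>
    simp only [barTensorBd, map_tmul, LinearMap.add_apply, LinearMap.id_apply, map_add, sgn_sgn,
      sgn_barBd, LinearMap.comp_apply, neg_tmul, tmul_add]
    abel

/-- For a cycle of degree `n + 1`, both factors of the reduced diagonal have degrees between `1`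
and `n`, so a contraction in these degrees fills it. -/
theorem IsContraction.barTensorBd_map_reducedDiag {h : ListChain G →ₗ[ℝ] ListChain G} {K : ℝ}
    {n : ℕ}
    (hh : IsContraction h K n) {z : ListChain G} (hz : z ∈ degree G (n + 1)) (hz₀ : barBd z = 0) :
    barTensorBd (TensorProduct.map sgn h (reducedDiag z)) = reducedDiag z := by
  have h₁ := barTensorBd_map_sgn h (reducedDiag z)
  rw [barTensorBd_reducedDiag, hz₀, map_zero, map_zero, add_zero] at h₁
  rw [h₁]
  refine map_eq_of_mem_degree (L := TensorProduct.map LinearMap.id (barBd ∘ₗ h + h ∘ₗ barBd) ∘ₗ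
    reducedDiag) (fun l hl => ?_) hz
  rw [LinearMap.comp_apply, reducedDiag_single l (by rintro rfl; simp at hl), map_sum]
  refine Finset.sum_congr rfl fun i hi => ?_
  have hi := Finset.mem_range.1 hi
  have hlen : (l.drop (i + 1)).length = (n - i - 1) + 1 := by
    rw [List.length_drop]
    omega
  rw [map_tmul, LinearMap.add_apply, LinearMap.comp_apply, LinearMap.comp_apply,
    hh.barBd_add _ (by omega), coeffNil_eq_zero (single_mem_degree hlen 1)]
  simp

theorem IsMitotic.exists_mitosis (hG : IsMitotic G) {H : Subgroup G} (hH : H.FG) :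
    ∃ s d : G, (∀ g ∈ H, d * g * d⁻¹ = g * (s * g * s⁻¹)) ∧
      ∀ g ∈ H, ∀ g' ∈ H, Commute g (s * g' * s⁻¹) := by
  obtain ⟨M, hM, s, d, -, h₁, h₂⟩ := hG H hH
  refine ⟨s, d, fun g hg => ?_, fun g hg g' hg' => ?_⟩
  · have := h₁ ⟨g, hM hg⟩ (Subgroup.mem_subgroupOf.2 hg)
    simpa using congrArg (Subtype.val) this
  · have := h₂ ⟨g', hM hg'⟩ (Subgroup.mem_subgroupOf.2 hg') ⟨g, hM hg⟩
      (Subgroup.mem_subgroupOf.2 hg)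
    have := congrArg (Subtype.val) this
    simp only [Subgroup.coe_mul, InvMemClass.coe_inv, OneMemClass.coe_one] at this
    exact commutatorElement_eq_one_iff_commute.1 this

/-- The heart of the argument, an explicit filling of a cycle `z` with entries in `H`, given a
filling `t` of its reduced diagonal. The map `μ` sends the diagonal of `z` to its conjugate by `d`,
and the three parts `1 × z`, `z × 1` and the cross terms of the Alexander–Whitney diagonal to the
conjugate of `z` by `s`, to `z`, and to a boundary. -/
theorem exists_boundary_of_mitosis {n : ℕ} {z : ListChain G} (hz : z ∈ degree G (n + 1))
    {H : Subgroup G} {s d : G} (hd : ∀ g ∈ H, d * g * d⁻¹ = g * (s * g * s⁻¹))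
    (hs : ∀ g ∈ H, ∀ g' ∈ H, Commute g (s * g' * s⁻¹))
    {zH : ListChain H} (hzH : mapChain H.subtype zH = z) (hzH₀ : barBd zH = 0)
    {t : ListChain H ⊗[ℝ] ListChain H} (ht : barTensorBd t = reducedDiag zH) :
    ∃ μ : H × H →* G,
      barBd (conjHomotopy d z - conjHomotopy s z - mapChain μ (TensorProduct.lift barCross t) -
        mapChain μ (barDiagHomotopy zH)) = z := by
  let μ : H × H →* G := MonoidHom.noncommCoprod H.subtype
    ((MulAut.conj s).toMonoidHom.comp H.subtype) fun a b => hs a a.2 b b.2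
  have hμ (a b : H) : μ (a, b) = a * (s * b * s⁻¹) := rfl
  refine ⟨μ, ?_⟩
  have hz₀ : barBd z = 0 := by rw [← hzH, barBd_mapChain, hzH₀, map_zero]
  have hdiag : mapChain μ (mapChain (fun x => (x, x)) zH) = mapChain (fun g => d * g * d⁻¹) z := by
    rw [← hzH, mapChain_mapChain, mapChain_mapChain]
    congr 2
    funext x
    exact (hd x x.2).symm
  have hinl : mapChain μ (mapChain (MonoidHom.inl H H) zH) = z := by
    rw [mapChain_mapChain]
    conv_rhs => rw [← hzH]
    congr 2
    funext x
    simp [hμ]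
  have hinr : mapChain μ (mapChain (MonoidHom.inr H H) zH) = mapChain (fun g => s * g * s⁻¹) z := by
    rw [← hzH, mapChain_mapChain, mapChain_mapChain]
    congr 2
    funext x
    simp [hμ]
  have hcoeff : coeffNil zH = 0 := by
    rw [← coeffNil_mapChain H.subtype, hzH, coeffNil_eq_zero hz]
  have hbarDiag : barDiag zH = reducedDiag zH + single [] (1 : ℝ) ⊗ₜ zH +
      zH ⊗ₜ single [] (1 : ℝ) := by
    rw [reducedDiag_apply, hcoeff]
    module
  simp only [map_sub, barBd_conjHomotopy, hz₀, map_zero, barBd_mapChain, barBd_lift_barCross, ht,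
    barBd_barDiagHomotopy, hzH₀, hbarDiag, map_add, lift.tmul, barCross_nil_left,
    barCross_nil_right, hdiag, hinl, hinr]
  abel

open scoped Classical in
/-- The inductive step for the uniform boundary condition of mitotic groups. -/
theorem IsContraction.uniformBoundary (hG : IsMitotic G) {h : ListChain G →ₗ[ℝ] ListChain G}
    {K : ℝ} {n : ℕ} (hh : IsContraction h K n) : UniformBoundary G (n + 1) := by
  have hK : 0 ≤ K := (norm1_nonneg _).trans (hh.norm1_le [])
  choose KX hKX₀ hKX using fun p q => exists_norm1_barCross_le p q
  obtain ⟨KD, hKD₀, hKD⟩ := exists_norm1_barDiagHomotopy_le (n + 1)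
  -- a bound for the products of the factors of degrees `i + 1` and `n - i + 1`
  let KT : ℝ := ∑ i ∈ Finset.range n, KX (i + 1) (n - i + 1) * K
  refine ⟨(n + 2) + (n + 2) + KT + KD, fun z hz hz₀ => ?_⟩
  -- a finitely generated subgroup that contains all entries of all chains that occur
  let S : Finset G := z.support.biUnion fun l => l.toFinset ∪ (Finset.range n).biUnion fun i =>
    (h (single (l.drop (i + 1)) 1)).support.biUnion List.toFinset
  let H : Subgroup G := Subgroup.closure S
  have hHfg : H.FG := ⟨S, rfl⟩
  have hH₁ : ∀ l ∈ z.support, ∀ x ∈ l, x ∈ H := fun l hl x hx =>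
    Subgroup.subset_closure <| Finset.mem_biUnion.2
      ⟨l, hl, Finset.mem_union_left _ (List.mem_toFinset.2 hx)⟩
  have hH₂ : ∀ l ∈ z.support, ∀ i < n, ∀ m ∈ (h (single (l.drop (i + 1)) 1)).support,
      ∀ x ∈ m, x ∈ H := fun l hl i hi m hm x hx =>
    Subgroup.subset_closure <| Finset.mem_biUnion.2 ⟨l, hl, Finset.mem_union_right _ <|
      Finset.mem_biUnion.2 ⟨i, Finset.mem_range.2 hi,
        Finset.mem_biUnion.2 ⟨m, hm, List.mem_toFinset.2 hx⟩⟩⟩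
  obtain ⟨s, d, hd, hs⟩ := hG.exists_mitosis hHfg
  -- a set-theoretic retraction of `G` onto `H`
  let ρ : G → H := fun g => if hg : g ∈ H then ⟨g, hg⟩ else 1
  have hρ (x : G) (hx : x ∈ H) : (H.subtype ∘ ρ) x = x := by simp [ρ, hx]
  have hρ' : ρ ∘ H.subtype = id := by
    funext x
    simp [ρ]
  have hleft (c : ListChain H) : mapChain ρ (mapChain H.subtype c) = c := by
    rw [mapChain_mapChain, hρ', mapChain_id]
  have hleftT : Function.LeftInverse (TensorProduct.map (mapChain ρ) (mapChain ρ))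
      (TensorProduct.map (mapChain H.subtype) (mapChain H.subtype)) := by
    intro t
    induction t with
    | zero => simp
    | add a b ha hb => simp only [map_add, ha, hb]
    | tmul a b => simp only [map_tmul, hleft]
  let zH := mapChain ρ z
  have hzH : mapChain H.subtype zH = z := by
    rw [mapChain_mapChain]
    exact mapChain_eq_self fun l hl x hx => hρ x (hH₁ l hl x hx)
  have hzH₀ : barBd zH = 0 := by
    rw [← hleft (barBd zH), ← barBd_mapChain, hzH, hz₀, map_zero]
  -- the filling of the reduced diagonal of `z`, transported from `G` to `H`
  let Φ : ListChain G →ₗ[ℝ] ListChain H ⊗[ℝ] ListChain H :=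
    TensorProduct.map (mapChain ρ) (mapChain ρ) ∘ₗ TensorProduct.map sgn h ∘ₗ reducedDiag
  -- nothing is lost by the retraction, as all entries that occur at `z` lie in `H`
  have hΦ : TensorProduct.map (mapChain H.subtype) (mapChain H.subtype) (Φ z) =
      TensorProduct.map sgn h (reducedDiag z) := by
    rw [← Finsupp.sum_single z, Finsupp.sum]
    simp only [map_sum]
    refine Finset.sum_congr rfl fun l hl => ?_
    have hlen := mem_degree.1 hz l hl
    rw [← mul_one (z l), ← smul_eq_mul, ← Finsupp.smul_single]
    simp only [map_smul, Φ, LinearMap.comp_apply]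
    rw [reducedDiag_single l (by rintro rfl; simp at hlen)]
    simp only [map_sum, map_tmul, mapChain_mapChain]
    congr 1
    refine Finset.sum_congr rfl fun i hi => ?_
    rw [hlen, Nat.add_sub_cancel, Finset.mem_range] at hi
    congr 1
    · rw [sgn_single, map_smul, mapChain_eq_self]
      intro m hm x hx
      rw [Finset.mem_singleton.1 (Finsupp.support_single_subset hm)] at hx
      exact hρ x (hH₁ l hl x (List.mem_of_mem_take hx))
    · exact mapChain_eq_self fun m hm x hx => hρ x (hH₂ l hl i hi m hm x hx)
  have ht : barTensorBd (Φ z) = reducedDiag zH := by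
    refine hleftT.injective ?_
    rw [map_barTensorBd, hΦ, hh.barTensorBd_map_reducedDiag hz hz₀, ← reducedDiag_mapChain, hzH]
  obtain ⟨μ, hμ⟩ := exists_boundary_of_mitosis hz hd hs hzH hzH₀ ht
  -- truncation to the right degree keeps the boundary and does not increase the norm
  refine ⟨degreeProj G (n + 1 + 1) (conjHomotopy d z - conjHomotopy s z -
    mapChain μ (TensorProduct.lift barCross (Φ z)) - mapChain μ (barDiagHomotopy zH)),
    degreeProj_mem _ _, ?_, (norm1_degreeProj_le _ _).trans ?_⟩
  · rw [barBd_degreeProj, hμ, degreeProj_of_mem hz]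
  have e₁ := norm1_conjHomotopy_le d hz
  have e₂ := norm1_conjHomotopy_le s hz
  have e₃ : norm1 (mapChain μ (TensorProduct.lift barCross (Φ z))) ≤ KT * norm1 z := by
    refine (norm1_mapChain_le _ _).trans
      (norm1_map_le_of_mem_degree (L := TensorProduct.lift barCross ∘ₗ Φ) (fun l hl => ?_) hz)
    simp only [Φ, LinearMap.comp_apply]
    rw [reducedDiag_single l (by rintro rfl; simp at hl)]
    simp only [map_sum, map_tmul, lift.tmul]
    refine (norm1_sum_le _ _).trans ?_
    rw [hl, Nat.add_sub_cancel]
    refine Finset.sum_le_sum fun i hi => ?_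
    rw [Finset.mem_range] at hi
    have hdrop : (l.drop (i + 1)).length = n - i := by rw [List.length_drop]; omega
    have htake : sgn (single (l.take (i + 1)) 1) ∈ degree G (i + 1) := by
      rw [sgn_single]
      exact Submodule.smul_mem _ _ (single_mem_degree (by rw [List.length_take]; omega) _)
    refine (hKX (i + 1) (n - i + 1) _ _ (mapChain_mem_degree ρ htake)
      (mapChain_mem_degree ρ (hdrop ▸ hh.map_mem_degree _))).trans ?_
    have hn₁ : norm1 (mapChain ρ (sgn (single (l.take (i + 1)) 1))) ≤ 1 := by
      refine (norm1_mapChain_le _ _).trans ?_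
      rw [sgn_single, norm1_smul]
      simp
    have hn₂ := (norm1_mapChain_le ρ _).trans (hh.norm1_le (l.drop (i + 1)))
    have := hKX₀ (i + 1) (n - i + 1)
    refine mul_le_mul (mul_le_of_le_one_right this hn₁) hn₂ (norm1_nonneg _) this
  have e₄ : norm1 (mapChain μ (barDiagHomotopy zH)) ≤ KD * norm1 z := by
    exact (norm1_mapChain_le _ _).trans ((hKD _ (mapChain_mem_degree ρ hz)).trans
      (mul_le_mul_of_nonneg_left (norm1_mapChain_le _ _) hKD₀))
  push_cast at e₁ e₂
  have f₁ := norm1_sub_le (conjHomotopy d z - conjHomotopy s z -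
    mapChain μ (TensorProduct.lift barCross (Φ z))) (mapChain μ (barDiagHomotopy zH))
  have f₂ := norm1_sub_le (conjHomotopy d z - conjHomotopy s z)
    (mapChain μ (TensorProduct.lift barCross (Φ z)))
  have f₃ := norm1_sub_le (conjHomotopy d z) (conjHomotopy s z)
  linarith

theorem IsMitotic.uniformBoundary (hG : IsMitotic G) (n : ℕ) : UniformBoundary G (n + 1) := by
  induction n using Nat.strong_induction_on with
  | _ n ih =>
    obtain ⟨h, K, hh⟩ := exists_isContraction (G := G) n fun m h0 hm => by
      obtain ⟨k, rfl⟩ := Nat.exists_eq_succ_of_ne_zero h0.ne'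
      exact ih k hm
    exact hh.uniformBoundary hG

end UniformBoundary

section Comparison
variable {G : Type*}

/-! ### Comparison with tuples -/

/-- The chains on tuples of length `k`, viewed as chains on lists. -/
noncomputable def toListChain {k : ℕ} : BarChain G k →ₗ[ℝ] ListChain G :=
  lmapDomain ℝ ℝ List.ofFn

@[simp] theorem toListChain_single {k : ℕ} (g : Fin k → G) (r : ℝ) :
    toListChain (single g r) = single (List.ofFn g) r := by simp [toListChain]

theorem toListChain_injective {k : ℕ} :
    Function.Injective (toListChain : BarChain G k → ListChain G) :=
  Finsupp.mapDomain_injective List.ofFn_injective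

theorem norm1_toListChain {k : ℕ} (c : BarChain G k) : norm1 (toListChain c) = l1Norm c :=
  Finsupp.sum_mapDomain_index_inj List.ofFn_injective

theorem toListChain_mem_degree {k : ℕ} (c : BarChain G k) : toListChain c ∈ degree G k := by
  rw [← Finsupp.sum_single c, Finsupp.sum, map_sum]
  refine Submodule.sum_mem _ fun g _ => ?_
  rw [toListChain_single]
  exact single_mem_degree (by simp) _

theorem exists_toListChain_eq {k : ℕ} {c : ListChain G} (hc : c ∈ degree G k) :
    ∃ c' : BarChain G k, toListChain c' = c := by
  refine map_mem_of_mem_degree (L := LinearMap.id)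
    (S := LinearMap.range (toListChain : BarChain G k →ₗ[ℝ] ListChain G)) (fun l hl => ?_) hc
  subst hl
  exact ⟨single l.get 1, by simp⟩

variable [Group G]

theorem getElem_diffs (x : G) (l : List G) (i : ℕ) (hi : i < (diffs x l).length) :
    (diffs x l)[i] = ((x :: l)[i]'(by simp [length_diffs] at hi; simp; omega))⁻¹ *
      (x :: l)[i + 1]'(by simp [length_diffs] at hi; simp; omega) := by
  induction l generalizing x i with
  | nil => simp [diffs] at hi
  | cons y l ih =>
    cases i with
    | zero => simp [diffs]
    | succ i => simp [diffs, ih]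

theorem getElem_walk_succ (x : G) (l : List G) (i : ℕ) (hi : i < l.length) :
    (walk x l)[i + 1]'(by rw [length_walk]; omega) =
      (walk x l)[i]'(by rw [length_walk]; omega) * l[i] := by
  induction l generalizing x i with
  | nil => simp at hi
  | cons g l ih =>
    cases i with
    | zero => cases l <;> simp [walk]
    | succ i =>
      simp only [walk, List.getElem_cons_succ]
      exact ih (x * g) i (by simpa using hi)

/-- The faces of the simplex `1, g₁, g₁ g₂, …` are the faces of the tuple `g`. -/
theorem toBar_eraseIdx_walk_ofFn {k : ℕ} (g : Fin (k + 1) → G) (j : Fin (k + 2)) :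
    toBar (single ((walk 1 (List.ofFn g)).eraseIdx j) (1 : ℝ)) =
      single (List.ofFn (barFace j g)) 1 := by
  set w := walk 1 (List.ofFn g) with hw
  have hwl : w.length = k + 2 := by simp [hw, length_walk]
  have hstep (i : ℕ) (hi : i < k + 1) : w[i + 1] = w[i] * g ⟨i, hi⟩ := by
    have := getElem_walk_succ 1 (List.ofFn g) i (by simpa using hi)
    rw [List.getElem_ofFn] at this
    exact this
  have hlen : (w.eraseIdx j).length = k + 1 := by
    rw [List.length_eraseIdx_of_lt (by omega), hwl]
    rfl
  cases he : w.eraseIdx j with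
  | nil => simp [he] at hlen
  | cons x m =>
    rw [toBar_cons]
    congr 1
    have hm : m.length = k := by simpa [he] using hlen
    refine List.ext_getElem (by simp [length_diffs, hm]) fun i hi₁ hi₂ => ?_
    have hi : i < k := by simpa using hi₂
    rw [getElem_diffs, List.getElem_ofFn]
    simp only [← he, List.getElem_eraseIdx, barFace]
    have h₀ := hstep i (by omega)
    have h₁ := hstep (i + 1) (by omega)
    split_ifs with a b c d e <;> first | omega | skip
    · rw [h₀, inv_mul_cancel_left]; rfl
    · rw [h₁, h₀, mul_assoc, inv_mul_cancel_left]; rfl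
    · rw [h₁, inv_mul_cancel_left]; rfl

/-- The two descriptions of the bar complex agree. -/
theorem toListChain_barBoundary {k : ℕ} (c : BarChain G (k + 1)) :
    toListChain (barBoundary G k c) = barBd (toListChain c) := by
  suffices h : toListChain ∘ₗ barBoundary G k = barBd ∘ₗ toListChain from LinearMap.congr_fun h c
  refine Finsupp.lhom_ext' fun g => LinearMap.ext_ring ?_
  simp only [LinearMap.comp_apply, lsingle_apply, toListChain_single, barBd_single, barBoundary,
    linearCombination_single, one_smul, map_sum, map_smul, List.length_ofFn]
  rw [Finset.sum_range]
  exact Finset.sum_congr rfl fun j _ => by rw [toBar_eraseIdx_walk_ofFn]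

theorem UniformBoundary.exists_barBoundary_eq {n : ℕ} (h : UniformBoundary G (n + 1)) :
    ∃ K : ℝ, 0 ≤ K ∧ ∀ z : BarChain G (n + 1), barBoundary G n z = 0 →
      ∃ b : BarChain G (n + 2), barBoundary G (n + 1) b = z ∧ l1Norm b ≤ K * l1Norm z := by
  obtain ⟨K, hK⟩ := h
  refine ⟨|K|, abs_nonneg K, fun z hz => ?_⟩
  obtain ⟨b, hb₁, hb₂, hb₃⟩ := hK (toListChain z) (toListChain_mem_degree z)
    (by rw [← toListChain_barBoundary, hz, map_zero])
  obtain ⟨b, rfl⟩ := exists_toListChain_eq hb₁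
  refine ⟨b, toListChain_injective ((toListChain_barBoundary b).trans hb₂), ?_⟩
  rw [← norm1_toListChain, ← norm1_toListChain]
  exact hb₃.trans (mul_le_mul_of_nonneg_right (le_abs_self K) (norm1_nonneg _))

/-- If `f` vanishes on cycles and boundaries have controlled fillings, then `f` is a bounded
coboundary: on boundaries the primitive is forced and bounded, and it extends by the Hahn–Banach
theorem. -/
theorem exists_bddCochain_coboundary_eq {n : ℕ} {f : Cochain G (n + 1)}
    (hf : f ∈ BddCochain G (n + 1))
    (hker : ∀ z, barBoundary G n z = 0 → f z = 0) {K : ℝ} (hK₀ : 0 ≤ K)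
    (hK : ∀ c : BarChain G (n + 1), ∃ c', barBoundary G n c' = barBoundary G n c ∧
      l1Norm c' ≤ K * l1Norm (barBoundary G n c)) :
    ∃ φ ∈ BddCochain G n, coboundary G n φ = f := by
  obtain ⟨D, hD⟩ := hf
  have hf' : f ∈ LinearMap.range (barBoundary G n).dualMap := by
    rw [LinearMap.range_dualMap_eq_dualAnnihilator_ker, Submodule.mem_dualAnnihilator]
    exact fun z hz => hker z hz
  obtain ⟨φ₀, hφ₀⟩ := hf'
  have hφ₀' (c : BarChain G (n + 1)) : φ₀ (barBoundary G n c) = f c := LinearMap.congr_fun hφ₀ c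
  have hbound (c : BarChain G (n + 1)) :
      φ₀ (barBoundary G n c) ≤ |D| * K * l1Norm (barBoundary G n c) := by
    obtain ⟨c', hc', hn⟩ := hK c
    rw [← hc', hφ₀', hc']
    calc f c' ≤ D * l1Norm c' := (le_abs_self _).trans (hD c')
      _ ≤ |D| * l1Norm c' := mul_le_mul_of_nonneg_right (le_abs_self D) (norm1_nonneg c')
      _ ≤ |D| * (K * l1Norm (barBoundary G n c)) :=
        mul_le_mul_of_nonneg_left hn (abs_nonneg D)
      _ = _ := by ring
  obtain ⟨φ, hφ₁, hφ₂⟩ := exists_extension_of_le_sublinear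
    ⟨LinearMap.range (barBoundary G n), φ₀.domRestrict _⟩
    (fun c => |D| * K * l1Norm c)
    (fun r hr c => by
      change _ * norm1 (r • c) = r * (_ * norm1 c)
      rw [norm1_smul, abs_of_pos hr]
      ring)
    (fun c d => by
      rw [← mul_add]
      exact mul_le_mul_of_nonneg_left (norm1_add_le c d) (by positivity))
    (by
      rintro ⟨_, c, rfl⟩
      exact hbound c)
  refine ⟨φ, ⟨|D| * K, fun c => abs_le.2 ⟨?_, hφ₂ c⟩⟩, ?_⟩
  · have := hφ₂ (-c)
    rw [map_neg] at this
    change _ ≤ _ * norm1 (-c) at this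
    rw [norm1_neg] at this
    exact neg_le.1 this
  · refine LinearMap.ext fun c => ?_
    rw [← hφ₀' c]
    exact hφ₁ ⟨barBoundary G n c, c, rfl⟩

theorem IsMitotic.subsingleton_bddCohomology (hG : IsMitotic G) (n : ℕ) :
    Subsingleton (BddCohomology G (n + 1)) := by
  rw [subsingleton_bddCohomology_iff]
  rintro f ⟨hf, hf₀⟩
  have hker (z : BarChain G (n + 1)) (hz : barBoundary G n z = 0) : f z = 0 := by
    obtain ⟨K, -, hK⟩ := (hG.uniformBoundary n).exists_barBoundary_eq
    obtain ⟨b, rfl, -⟩ := hK z hz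
    exact LinearMap.congr_fun hf₀ b
  cases n with
  | zero =>
    -- degree `1` needs no fillings, since the boundary operator vanishes there
    have h₀ (c : BarChain G 1) : barBoundary G 0 c = 0 := by
      suffices h : barBoundary G 0 = 0 from LinearMap.congr_fun h c
      refine Finsupp.lhom_ext' fun g => LinearMap.ext_ring ?_
      simp [barBoundary_single, Subsingleton.elim (Fin.tail g) (Fin.init g)]
    exact exists_bddCochain_coboundary_eq hf hker le_rfl (K := 0)
      fun c => ⟨0, by simp [h₀], by simp [l1Norm]⟩
  | succ n =>
    obtain ⟨K, hK₀, hK⟩ := (hG.uniformBoundary n).exists_barBoundary_eq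
    exact exists_bddCochain_coboundary_eq hf hker hK₀
      fun c => hK _ (LinearMap.congr_fun (barBoundary_comp G n) c)

end Comparison

end BoundedCohomology

theorem theorem1p2 {G : Type*} [Group G] (hG : BoundedCohomology.IsMitotic G) :
    BoundedCohomology.bcd G = 0 ∧
      ∀ n : ℕ, 0 < n → Subsingleton (BoundedCohomology.BddCohomology G n) := by
  have h : ∀ n : ℕ, 0 < n → Subsingleton (BoundedCohomology.BddCohomology G n) := by
    intro n hn
    obtain ⟨m, rfl⟩ := Nat.exists_eq_succ_of_ne_zero hn.ne'
    exact hG.subsingleton_bddCohomology m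
  refine ⟨?_, h⟩
  rw [BoundedCohomology.bcd, ← nonpos_iff_eq_zero]
  refine sSup_le ?_
  rintro _ ⟨n, hn, rfl⟩
  rcases Nat.eq_zero_or_pos n with rfl | hpos
  · simp
  · exact absurd (h n hpos) hn
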